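/- Let $S^3\subset\mathbb R^4$ be the standard unit sphere with surface measure $\mu$ and Laplace–Beltrami operator $\Delta$ (with nonpositive spectrum), and let $$P\varphi=\Delta^2\varphi+\tfrac12\Delta\varphi-\tfrac{15}{16}\varphi$$ be the Paneitz operator. For $\varepsilon\in\mathbb R$, a Green's function of $P+\varepsilon$ is a continuous function $G$ on $S^3\times S^3$ with $$\int_{S^3}G(x,y)\,(P\varphi+\varepsilon\varphi)(y)\,d\mu(y)=\varphi(x)\qquad\text{for all }\varphi\in C^\infty(S^3),\ x\in S^3 .$$ For functions $k_1,k_2$ on $[-1,1]$ let $(k_1*k_2)(t)=\int_{S^3}k_1(x\cdot y)\,k_2(y\cdot z)\,d\mu(y)$, where $x,z\in S^3$ are any points with $x\cdot z=t$, and let $k^{*(j+1)}=k*\cdots*k$ ($j+1$ factors). Put $$k(t)=\frac{\sqrt{1-t}}{4\sqrt2\,\pi},\qquad t\in[-1,1].$$ There is $\varepsilon_0>0$ such that for every $\varepsilon\in(0,\varepsilon_0)$ the following holds. The operator $P+\varepsilon$ has exactly one Green's function $G_{P+\varepsilon}$; there is a function $k_\varepsilon$ on $[-1,1]$ with $$k_\varepsilon(x\cdot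 y)=-G_{P+\varepsilon}(x,y)\quad\text{for all }x,y\in S^3;$$ it is given by the convergent series $$k_\varepsilon(t)=\sum_{j=0}^\infty\varepsilon^j\,k^{*(j+1)}(t),\qquad t\in[-1,1];$$ and $k_\varepsilon$ is strictly decreasing on $[-1,1]$. -/

import Mathlib

open MeasureTheory Metric Set
open scoped Manifold ContDiff InnerProductSpace Laplacian Pointwise

noncomputable section

namespace PaneitzSphere

/-- The Euclidean space `ℝ⁴`. -/
abbrev R4 : Type := EuclideanSpace ℝ (Fin 4)

/-- The standard three sphere, the unit sphere of `ℝ⁴`. -/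
abbrev S3 : Type := sphere (0 : R4) 1

/-- The Riemannian volume measure of the standard `S³`: the surface measure induced by Lebesgue
measure of `ℝ⁴` (total mass `4 · vol(B⁴) = 2π²`). -/
abbrev sphereMeasure : Measure S3 := (volume : Measure R4).toSphere

/-- The extension of a function on `S³` to `ℝ⁴ ∖ {0}` that is homogeneous of degree `0`:
`x ↦ f (x / ‖x‖)` (with the irrelevant value `0` at the origin). -/
def homExt (f : S3 → ℝ) (x : R4) : ℝ :=
  open Classical in
  if h : x ≠ 0 then f ⟨‖x‖⁻¹ • x, by simp [norm_smul, h]⟩ else 0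

/-- The Laplace–Beltrami operator of the standard `S³` (with nonpositive spectrum): the restriction
to `S³` of the Laplacian in `ℝ⁴` of the degree `0` homogeneous extension. -/
def sphereLaplacian (f : S3 → ℝ) (p : S3) : ℝ := (Δ (homExt f)) (p : R4)

/-- The Paneitz operator `P φ = Δ² φ + (1/2) Δ φ - (15/16) φ` on the standard `S³`. -/
def paneitz (φ : S3 → ℝ) (p : S3) : ℝ :=
  sphereLaplacian (sphereLaplacian φ) p + 1 / 2 * sphereLaplacian φ p - 15 / 16 * φ p

/-- `G` is the (continuous) Green's function on `S³` of the formally self-adjoint operator `A`: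
for each `x`, `A (G (x, ·)) = δ_x` in the sense of distributions, that is,
`∫ G (x, y) (A φ) (y) dμ(y) = φ (x)` for all `φ ∈ C^∞(S³)`. -/
structure IsGreenFunction (A : (S3 → ℝ) → (S3 → ℝ)) (G : S3 → S3 → ℝ) : Prop where
  continuous : Continuous (Function.uncurry G)
  integral_eq : ∀ φ : S3 → ℝ, ContMDiff (𝓡 3) 𝓘(ℝ, ℝ) ∞ φ →
    ∀ x : S3, ∫ y, G x y * A φ y ∂sphereMeasure = φ x

/-- The profile `k(t) = √(1 - t) / (4 √2 π)`. -/
def kProfile (t : ℝ) : ℝ := √(1 - t) / (4 * √2 * Real.pi)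

/-- The north pole `(0, 0, 0, 1)`. -/
def northPole : R4 := !₂[0, 0, 0, 1]

/-- For `t ∈ [-1, 1]`, a point of `S³` whose inner product with the north pole is `t`. -/
def pointAt (t : ℝ) : R4 := !₂[√(1 - t ^ 2), 0, 0, t]

/-- The convolution of two functions on `[-1, 1]`:
`(k₁ * k₂)(t) = ∫_{S³} k₁ (x · y) k₂ (y · z) dμ(y)` for `x, z ∈ S³` with `x · z = t`.
It does not depend on the choice of `x` and `z`, see `conv_inner`. -/
def conv (k₁ k₂ : ℝ → ℝ) (t : ℝ) : ℝ :=
  ∫ y : S3, k₁ ⟪northPole, (y : R4)⟫_ℝ * k₂ ⟪(y : R4), pointAt t⟫_ℝ ∂sphereMeasure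

/-- `convPow k j` is the convolution `k * ⋯ * k` with `j + 1` factors. -/
def convPow (k : ℝ → ℝ) : ℕ → ℝ → ℝ
  | 0 => k
  | j + 1 => conv k (convPow k j)

/-- The action of an orthogonal transformation on `S³`. -/
def rot (R : R4 ≃ₗᵢ[ℝ] R4) (y : S3) : S3 := ⟨R y, by simp⟩

theorem rot_measurePreserving (R : R4 ≃ₗᵢ[ℝ] R4) :
    MeasurePreserving (rot R) sphereMeasure sphereMeasure := by
  have hm : Measurable (rot R) :=
    (Continuous.subtype_mk (R.continuous.comp continuous_subtype_val) _).measurable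
  refine ⟨hm, ?_⟩
  ext s hs
  rw [Measure.map_apply hm hs, Measure.toSphere_apply' _ (hm hs), Measure.toSphere_apply' _ hs]
  congr 1
  have key : Ioo (0 : ℝ) 1 • ((fun y : S3 => (y : R4)) '' (rot R ⁻¹' s)) =
      R ⁻¹' (Ioo (0 : ℝ) 1 • ((fun y : S3 => (y : R4)) '' s)) := by
    ext v
    simp only [Set.mem_smul, Set.mem_image, Set.mem_preimage]
    constructor
    · rintro ⟨r, hr, w, ⟨y, hy, rfl⟩, rfl⟩
      exact ⟨r, hr, R y, ⟨rot R y, hy, rfl⟩, by simp⟩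
    · rintro ⟨r, hr, w, ⟨y, hy, rfl⟩, h⟩
      refine ⟨r, hr, R.symm y, ⟨rot R.symm y, ?_, rfl⟩, ?_⟩
      · have : rot R (rot R.symm y) = y := Subtype.ext (by simp [rot])
        rwa [this]
      · apply R.injective
        simpa using h
  rw [key]
  exact R.measurePreserving.measure_preimage_equiv (f := R.toMeasurableEquiv) _

/-- The orthogonal group acts transitively on pairs of unit vectors with given inner product. -/
theorem exists_rot {x z x' z' : R4} (hx : ‖x‖ = 1) (hz : ‖z‖ = 1) (hx' : ‖x'‖ = 1) (hz' : ‖z'‖ = 1)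
    (h : ⟪x, z⟫_ℝ = ⟪x', z'⟫_ℝ) : ∃ R : R4 ≃ₗᵢ[ℝ] R4, R x = x' ∧ R z = z' := by
  let R₁ : R4 ≃ₗᵢ[ℝ] R4 := (ℝ ∙ (x - x'))ᗮ.reflection
  have h₁ : R₁ x = x' := Submodule.reflection_sub (by rw [hx, hx'])
  let R₂ : R4 ≃ₗᵢ[ℝ] R4 := (ℝ ∙ (R₁ z - z'))ᗮ.reflection
  have h₂ : R₂ (R₁ z) = z' := Submodule.reflection_sub (by simp [hz, hz'])
  have h₃ : R₂ x' = x' := by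
    apply Submodule.reflection_mem_subspace_eq_self
    rw [Submodule.mem_orthogonal_singleton_iff_inner_right, inner_sub_left, real_inner_comm x' z',
      ← h, real_inner_comm x', ← h₁, R₁.inner_map_map, sub_self]
  exact ⟨R₁.trans R₂, by simp [h₁, h₃], by simp [h₂]⟩

/-- The convolution is the profile of the convolution of the two invariant kernels. -/
theorem conv_inner (k₁ k₂ : ℝ → ℝ) (x z : S3) :
    conv k₁ k₂ ⟪(x : R4), (z : R4)⟫_ℝ =
      ∫ y : S3, k₁ ⟪(x : R4), (y : R4)⟫_ℝ * k₂ ⟪(y : R4), (z : R4)⟫_ℝ ∂sphereMeasure := by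
  set t : ℝ := ⟪(x : R4), (z : R4)⟫_ℝ with ht
  have hx : ‖(x : R4)‖ = 1 := by simp
  have hz : ‖(z : R4)‖ = 1 := by simp
  have ht1 : t ^ 2 ≤ 1 := by
    have := abs_real_inner_le_norm (x : R4) (z : R4)
    rw [hx, hz, one_mul] at this
    exact (sq_le_one_iff_abs_le_one _).2 this
  have hn : ‖northPole‖ = 1 := by simp [northPole, EuclideanSpace.norm_eq, Fin.sum_univ_four]
  have hp : ‖pointAt t‖ = 1 := by
    simp [pointAt, EuclideanSpace.norm_eq, Fin.sum_univ_four,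
      Real.sq_sqrt (show 0 ≤ 1 - t ^ 2 by linarith)]
  obtain ⟨R, hRx, hRz⟩ := exists_rot hx hz hn hp
    (by simp [northPole, pointAt, PiLp.inner_apply, Fin.sum_univ_four, ← ht])
  have he : MeasurableEmbedding (rot R) :=
    (Continuous.subtype_mk (R.continuous.comp continuous_subtype_val) _).measurableEmbedding
      fun a b hab => Subtype.ext (R.injective (congrArg Subtype.val hab))
  rw [conv, ← (rot_measurePreserving R).integral_comp he]
  simp only [rot, ← hRx, ← hRz, R.inner_map_map]

end PaneitzSphere

end

open PaneitzSphere

/-! The kernel k is minus the fundamental solution of P. For c > 1 the function √(c - a·y) is smooth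
on the sphere, and P sends it to minus `peak c a`, an explicit positive multiple of (c -
a·y)^(-7/2). As c ↓ 1 this concentrates at a with total mass 4√2π. Since P is symmetric, letting c ↓
1 gives ∫ k(a·y) Pφ(y) dμ(y) = -φ(a) (`integral_kProfile_mul_paneitz`).

Let K be the integral operator with kernel k. Its sup norm is at most ∫ k = 16/15, so εK is a
contraction for small ε. Hence the Neumann series N converges and satisfies N = k + ε k*N, and every
continuous solution of h = εKh vanishes (`eq_zero_of_eq_integral_kProfile`). This fixed point
argument serves twice. Applied to φ plus the integral of N against (P + ε)φ, it shows that -N is a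
Green's function. Applied to the difference of two Green's functions, it gives uniqueness.

For monotonicity, k decreases in t at rate at least 1/(16π), so it suffices that k*N is Lipschitz in
t. A Lipschitz bound in the distance on S³ would not do: at the poles t varies only quadratically
with the distance. The convolution gains the missing order by a reflection argument
(`abs_conv_kProfile_sub_le`): reflecting z to z' makes the difference of the two second factors odd,
so the first factor can be antisymmetrised too. Each factor then contributes a distance, and the
product of these two distances is exactly 2|x·z - x·z'|.

All calculus on S³ takes place in ℝ⁴ ∖ {0}, on extensions homogeneous of degree 0. -/

open Filter Topology

noncomputable section

namespace PaneitzSphere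

/-! ### Homogeneous extensions and the smooth functions on the sphere -/

/-- The radial projection of a nonzero vector to the sphere. -/
def toS3 (x : R4) (hx : x ≠ 0) : S3 := ⟨‖x‖⁻¹ • x, by simp [norm_smul, hx]⟩

theorem homExt_of_ne {f : S3 → ℝ} {x : R4} (hx : x ≠ 0) : homExt f x = f (toS3 x hx) := by
  simp [homExt, hx, toS3]

theorem coe_ne_zero (p : S3) : (p : R4) ≠ 0 := ne_zero_of_mem_unit_sphere p

@[simp] theorem norm_coe (p : S3) : ‖(p : R4)‖ = 1 := by simp

@[simp] theorem homExt_coe (f : S3 → ℝ) (p : S3) : homExt f p = f p := by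
  rw [homExt_of_ne (coe_ne_zero p)]
  congr 1
  exact Subtype.ext (by simp [toS3])

theorem toS3_smul {r : ℝ} (hr : 0 < r) {x : R4} (hx : x ≠ 0) (h : r • x ≠ 0) :
    toS3 (r • x) h = toS3 x hx := by
  apply Subtype.ext
  simp only [toS3, norm_smul, Real.norm_eq_abs, abs_of_pos hr, smul_smul]
  congr 1
  field_simp

theorem homExt_smul (f : S3 → ℝ) {r : ℝ} (hr : 0 < r) (x : R4) :
    homExt f (r • x) = homExt f x := by
  by_cases hx : x = 0
  · simp [hx]
  · have h : r • x ≠ 0 := smul_ne_zero hr.ne' hx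
    rw [homExt_of_ne hx, homExt_of_ne h, toS3_smul hr hx h]

theorem homExt_comp₂ (F : ℝ → ℝ → ℝ) (f g : S3 → ℝ) {x : R4} (hx : x ≠ 0) :
    homExt (fun p => F (f p) (g p)) x = F (homExt f x) (homExt g x) := by
  simp [homExt_of_ne hx]

/-- Smoothness of a function on the sphere, in terms of its homogeneous extension. -/
def SmoothS (f : S3 → ℝ) : Prop := ContDiffOn ℝ ∞ (homExt f) {0}ᶜ

theorem contDiffAt_nat_of_top {f : R4 → ℝ} {x : R4} (hf : ContDiffAt ℝ ∞ f x) (n : ℕ) :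
    ContDiffAt ℝ n f x :=
  hf.of_le (by exact_mod_cast le_top)

theorem SmoothS.contDiffAt {f : S3 → ℝ} (hf : SmoothS f) {x : R4} (hx : x ≠ 0) :
    ContDiffAt ℝ ∞ (homExt f) x :=
  ContDiffOn.contDiffAt hf (isOpen_compl_singleton.mem_nhds hx)

theorem SmoothS.contDiffAt_nat {f : S3 → ℝ} (hf : SmoothS f) {x : R4} (hx : x ≠ 0) (n : ℕ) :
    ContDiffAt ℝ n (homExt f) x :=
  contDiffAt_nat_of_top (hf.contDiffAt hx) n

theorem contDiffAt_normalize {x : R4} (hx : x ≠ 0) :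
    ContDiffAt ℝ ∞ (fun x : R4 => ‖x‖⁻¹ • x) x :=
  ((contDiffAt_norm ℝ hx).inv (norm_ne_zero_iff.2 hx)).smul contDiffAt_id

/-- The extension is `φ` composed with the radial projection, a smooth map of manifolds from the
punctured space to the sphere. This is the only passage from charts to calculus in ℝ⁴. -/
theorem smoothS_of_contMDiff {φ : S3 → ℝ} (hφ : ContMDiff (𝓡 3) 𝓘(ℝ, ℝ) ∞ φ) : SmoothS φ := by
  intro x hx
  let U : TopologicalSpace.Opens R4 := ⟨{0}ᶜ, isOpen_compl_singleton⟩
  have h1 : ContMDiff 𝓘(ℝ, R4) 𝓘(ℝ, R4) ∞ (fun y : U => ‖(y : R4)‖⁻¹ • (y : R4)) := by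
    intro y
    exact (contMDiffAt_subtype_iff (f := fun x : R4 => ‖x‖⁻¹ • x)).2
      (contDiffAt_normalize y.2).contMDiffAt
  have hs : ∀ y : U, ‖(y : R4)‖⁻¹ • (y : R4) ∈ sphere (0 : R4) 1 := fun y => (toS3 y y.2).2
  have : Fact (Module.finrank ℝ R4 = 3 + 1) := ⟨finrank_euclideanSpace_fin⟩
  have h2 := hφ.comp (h1.codRestrict_sphere (n := 3) hs)
  have h3 : (φ ∘ Set.codRestrict _ _ hs : U → ℝ) = fun y : U => homExt φ y := by
    funext y
    rw [homExt_of_ne y.2]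
    rfl
  rw [h3] at h2
  have h4 := (contMDiffAt_subtype_iff (f := homExt φ)).1 (h2 ⟨x, hx⟩)
  exact h4.contDiffAt.contDiffWithinAt

theorem SmoothS.continuous {f : S3 → ℝ} (hf : SmoothS f) : Continuous f := by
  have h : f = fun p : S3 => homExt f p := by funext p; simp
  rw [h]
  exact (ContDiffOn.continuousOn hf).comp_continuous continuous_subtype_val coe_ne_zero

theorem SmoothS.of_eqOn {f : S3 → ℝ} {F : R4 → ℝ} (hF : ContDiffOn ℝ ∞ F {0}ᶜ)
    (h : ∀ p : S3, f p = F p) : SmoothS f := by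
  have h2 : ContDiffOn ℝ ∞ (fun x : R4 => F (‖x‖⁻¹ • x)) {0}ᶜ := by
    apply hF.comp (fun x hx => (contDiffAt_normalize hx).contDiffWithinAt)
    intro x hx
    exact coe_ne_zero (toS3 x hx)
  refine h2.congr fun x hx => ?_
  rw [homExt_of_ne hx, h]
  rfl

theorem SmoothS.add {f g : S3 → ℝ} (hf : SmoothS f) (hg : SmoothS g) :
    SmoothS (fun p => f p + g p) :=
  (ContDiffOn.add hf hg).congr fun _ hx => homExt_comp₂ (· + ·) f g hx

theorem SmoothS.const_mul {f : S3 → ℝ} (hf : SmoothS f) (c : ℝ) :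
    SmoothS (fun p => c * f p) :=
  (ContDiffOn.mul contDiffOn_const hf).congr fun _ hx => homExt_comp₂ (fun a _ => c * a) f f hx

theorem smoothS_const (c : ℝ) : SmoothS (fun _ => c) :=
  SmoothS.of_eqOn (F := fun _ => c) contDiffOn_const fun _ => rfl

theorem laplacian_congr {f₁ f₂ : R4 → ℝ} {x : R4} (h : f₁ =ᶠ[𝓝 x] f₂) : (Δ f₁) x = (Δ f₂) x :=
  (InnerProductSpace.laplacian_congr_nhds h).eq_of_nhds

theorem sphereLaplacian_add {f g : S3 → ℝ} (hf : SmoothS f) (hg : SmoothS g) (p : S3) :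
    sphereLaplacian (fun p => f p + g p) p = sphereLaplacian f p + sphereLaplacian g p := by
  have hp := coe_ne_zero p
  rw [sphereLaplacian, laplacian_congr (f₂ := homExt f + homExt g)]
  · exact (hf.contDiffAt_nat hp 2).laplacian_add (hg.contDiffAt_nat hp 2)
  · filter_upwards [isOpen_compl_singleton.mem_nhds hp] with x hx
    exact homExt_comp₂ (· + ·) f g hx

theorem sphereLaplacian_const_mul {f : S3 → ℝ} (hf : SmoothS f) (c : ℝ) (p : S3) :
    sphereLaplacian (fun p => c * f p) p = c * sphereLaplacian f p := by
  have hp := coe_ne_zero p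
  rw [sphereLaplacian, laplacian_congr (f₂ := c • homExt f)]
  · exact InnerProductSpace.laplacian_smul c (hf.contDiffAt_nat hp 2)
  · filter_upwards [isOpen_compl_singleton.mem_nhds hp] with x hx
    exact homExt_comp₂ (fun a _ => c * a) f f hx

theorem sphereLaplacian_const (c : ℝ) (p : S3) : sphereLaplacian (fun _ => c) p = 0 := by
  have hp := coe_ne_zero p
  rw [sphereLaplacian, laplacian_congr (f₂ := fun _ => c)]
  · simp
  · filter_upwards [isOpen_compl_singleton.mem_nhds hp] with x hx
    rw [homExt_of_ne hx]

/-- The standard basis of `ℝ⁴`. -/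
abbrev e (i : Fin 4) : R4 := EuclideanSpace.basisFun (Fin 4) ℝ i

theorem sum_sq_eq (x : R4) : ∑ i, (x i) ^ 2 = ‖x‖ ^ 2 := by
  rw [EuclideanSpace.norm_sq_eq]; simp

theorem laplacian_eq_sum_fderiv {f : R4 → ℝ} {x : R4} (hf : ContDiffAt ℝ 2 f x) :
    (Δ f) x = ∑ i, fderiv ℝ (fun y => fderiv ℝ f y (e i)) x (e i) := by
  rw [InnerProductSpace.laplacian_eq_iteratedFDeriv_orthonormalBasis f
    (EuclideanSpace.basisFun (Fin 4) ℝ)]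
  refine Finset.sum_congr rfl fun i _ => ?_
  rw [iteratedFDeriv_two_apply, fderiv_clm_apply]
  · simp
  · exact (hf.fderiv_right (m := 1) (by norm_num)).differentiableAt (by norm_num)
  · fun_prop

theorem ContDiffAt.laplacian_top {f : R4 → ℝ} {x : R4} (hf : ContDiffAt ℝ ∞ f x) :
    ContDiffAt ℝ ∞ (Δ f) x := by
  have h1 : ContDiffAt ℝ ∞
      (fun x => ∑ i, fderiv ℝ (fun y => fderiv ℝ f y (e i)) x (e i)) x := by
    apply ContDiffAt.sum
    intro i _
    have h := (hf.fderiv_right (m := ∞) le_rfl).clm_apply (contDiffAt_const (c := e i))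
    exact (h.fderiv_right (m := ∞) le_rfl).clm_apply contDiffAt_const
  apply h1.congr_of_eventuallyEq
  have h2 : ContDiffAt ℝ 2 f x := contDiffAt_nat_of_top hf 2
  filter_upwards [h2.eventually (by simp)] with y hy
  exact laplacian_eq_sum_fderiv hy

theorem SmoothS.sphereLaplacian {f : S3 → ℝ} (hf : SmoothS f) : SmoothS (sphereLaplacian f) :=
  SmoothS.of_eqOn (F := Δ (homExt f))
    (fun _ hx => (ContDiffAt.laplacian_top (hf.contDiffAt hx)).contDiffWithinAt) fun _ => rfl

/-! ### Self-adjointness of the Laplace–Beltrami operator -/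

/-- Constancy along rays, by Euler's relation: the gradient of the extension is tangent to the
spheres around the origin. -/
theorem fderiv_homExt_self {f : S3 → ℝ} (hf : SmoothS f) {x : R4} (hx : x ≠ 0) :
    fderiv ℝ (homExt f) x x = 0 := by
  have h1 : HasDerivAt (fun r : ℝ => r • x) x 1 := by
    simpa using (hasDerivAt_id (1 : ℝ)).smul_const x
  have h2 : HasFDerivAt (homExt f) (fderiv ℝ (homExt f) x) ((1 : ℝ) • x) := by
    rw [one_smul]
    exact ((hf.contDiffAt_nat hx 1).differentiableAt (by simp)).hasFDerivAt
  have h3 := h2.comp_hasDerivAt (1 : ℝ) h1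
  have h4 : HasDerivAt (homExt f ∘ fun r : ℝ => r • x) 0 1 := by
    apply (hasDerivAt_const (1 : ℝ) (homExt f x)).congr_of_eventuallyEq
    filter_upwards [lt_mem_nhds (zero_lt_one : (0 : ℝ) < 1)] with r hr
    exact homExt_smul f hr x
  exact h3.unique h4

theorem fderiv_homExt_smul (f : S3 → ℝ) {r : ℝ} (hr : 0 < r) (x v : R4) :
    fderiv ℝ (homExt f) (r • x) v = r⁻¹ * fderiv ℝ (homExt f) x v := by
  have h : (fun y => homExt f (r • y)) = homExt f := funext (homExt_smul f hr)
  have h1 := fderiv_comp_smul (f := homExt f) (x := x) r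
  rw [h] at h1
  rw [h1]
  simp [hr.ne']

theorem laplacian_homExt_smul {f : S3 → ℝ} (hf : SmoothS f) {r : ℝ} (hr : 0 < r) {x : R4}
    (hx : x ≠ 0) : (Δ (homExt f)) (r • x) = (r ^ 2)⁻¹ * (Δ (homExt f)) x := by
  rw [laplacian_eq_sum_fderiv (hf.contDiffAt_nat hx 2),
    laplacian_eq_sum_fderiv (hf.contDiffAt_nat (smul_ne_zero hr.ne' hx) 2), Finset.mul_sum]
  refine Finset.sum_congr rfl fun i _ => ?_
  have h1 := fderiv_comp_smul (f := fun y => fderiv ℝ (homExt f) y (e i)) (x := x) r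
  simp only [fderiv_homExt_smul f hr] at h1
  have h2 : DifferentiableAt ℝ (fun y => fderiv ℝ (homExt f) y (e i)) x :=
    (((hf.contDiffAt_nat hx 2).fderiv_right (m := 1) (by norm_num)).clm_apply
      contDiffAt_const).differentiableAt (by simp)
  rw [fderiv_const_mul h2] at h1
  have h3 := congrArg (fun L => L (e i)) h1
  simp only [smul_apply, smul_eq_mul] at h3
  rw [← mul_right_inj' hr.ne', ← h3]
  field_simp

/-! ### Polar coordinates and integration by parts against a radial cutoff -/

theorem integral_polar (ψ : ℝ → ℝ) (w : R4 → ℝ)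
    (hw : ∀ (r : ℝ) (p : S3), 0 < r → w (r • (p : R4)) = (r ^ 2)⁻¹ * w p) :
    ∫ x, ψ ‖x‖ * w x = (∫ p : S3, w p ∂sphereMeasure) *
      ∫ r : Ioi (0 : ℝ), ψ r * ((r : ℝ) ^ 2)⁻¹ ∂.volumeIoiPow (Module.finrank ℝ R4 - 1) := by
  have h := ((volume : Measure R4).measurePreserving_homeomorphUnitSphereProd.integral_comp
    (Homeomorph.measurableEmbedding _)
    (fun q : S3 × Ioi (0 : ℝ) => w q.1 * (ψ q.2 * ((q.2 : ℝ) ^ 2)⁻¹)))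
  rw [integral_prod_mul (fun p : S3 => w p) (fun r : Ioi (0 : ℝ) => ψ r * ((r : ℝ) ^ 2)⁻¹)] at h
  have h0 : ∫ x, ψ ‖x‖ * w x =
      ∫ x : ({0}ᶜ : Set R4), ψ ‖(x : R4)‖ * w x ∂(volume : Measure R4).comap Subtype.val := by
    rw [integral_subtype_comap (measurableSet_singleton (0 : R4)).compl (fun x => ψ ‖x‖ * w x),
      restrict_compl_singleton]
  rw [h0, ← h]
  apply integral_congr_ae
  filter_upwards with x
  have hx : (0 : ℝ) < ‖(x : R4)‖ := norm_pos_iff.2 x.2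
  have h1 : (x : R4) = ‖(x : R4)‖ • ((homeomorphUnitSphereProd R4 x).1 : R4) := by
    simp [homeomorphUnitSphereProd_apply_fst_coe, smul_smul, hx.ne']
  have h2 := hw _ (homeomorphUnitSphereProd R4 x).1 hx
  rw [← h1] at h2
  simp only [homeomorphUnitSphereProd_apply_snd_coe, h2]
  ring

/-- A radial cutoff function, supported away from the origin. -/
def cutoff : ContDiffBump (1 : ℝ) := ⟨1 / 4, 1 / 2, by norm_num, by norm_num⟩

theorem contDiff_cutoff : ContDiff ℝ ∞ (fun x : R4 => cutoff (‖x‖ ^ 2)) :=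
  cutoff.contDiff.comp (contDiff_norm_sq ℝ)

theorem tsupport_cutoff : tsupport (fun x : R4 => cutoff (‖x‖ ^ 2)) ⊆
    {x | 1 / 2 ≤ ‖x‖ ^ 2 ∧ ‖x‖ ^ 2 ≤ 3 / 2} := by
  apply closure_minimal
  · intro x hx
    have h : ‖x‖ ^ 2 ∈ Function.support cutoff := hx
    rw [cutoff.support_eq, mem_ball, Real.dist_eq, abs_lt] at h
    simp only [cutoff] at h
    exact ⟨by linarith, by linarith⟩
  · have hc : Continuous (fun x : R4 => ‖x‖ ^ 2) := by fun_prop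
    exact (isClosed_le continuous_const hc).inter (isClosed_le hc continuous_const)

theorem hasCompactSupport_cutoff : HasCompactSupport (fun x : R4 => cutoff (‖x‖ ^ 2)) := by
  apply HasCompactSupport.of_support_subset_isCompact (isCompact_closedBall (0 : R4) 2)
  intro x hx
  have h := tsupport_cutoff (subset_tsupport _ hx)
  rw [mem_closedBall_zero_iff]
  nlinarith [h.2, norm_nonneg x]

theorem tsupport_cutoff_subset_compl :
    tsupport (fun x : R4 => cutoff (‖x‖ ^ 2)) ⊆ {0}ᶜ := by
  intro x hx h
  have h1 := (tsupport_cutoff hx).1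
  rw [mem_singleton_iff.1 h] at h1
  norm_num at h1

theorem continuous_hasCompactSupport_mul_of_tsupport_subset {a b : R4 → ℝ} (ha : Continuous a)
    (hs : tsupport a ⊆ tsupport (fun x : R4 => cutoff (‖x‖ ^ 2))) (hb : ContinuousOn b {0}ᶜ) :
    Continuous (fun x => a x * b x) ∧ HasCompactSupport (fun x => a x * b x) := by
  have hsupp : tsupport (fun x => a x * b x) ⊆ tsupport a :=
    closure_mono (Function.support_mul_subset_left a b)
  constructor
  · exact (ha.continuousOn.mul hb).continuous_of_tsupport_subset isOpen_compl_singleton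
      (hsupp.trans (hs.trans tsupport_cutoff_subset_compl))
  · exact hasCompactSupport_cutoff.mono' ((subset_tsupport _).trans (hsupp.trans hs))

theorem continuous_fderiv_cutoff (v : R4) :
    Continuous (fun x => fderiv ℝ (fun x : R4 => cutoff (‖x‖ ^ 2)) x v) :=
  (contDiff_cutoff.continuous_fderiv (by simp)).clm_apply continuous_const

theorem integrable_cutoff_mul {b : R4 → ℝ} (hb : ContinuousOn b {0}ᶜ) :
    Integrable (fun x => cutoff (‖x‖ ^ 2) * b x) :=
  have h := continuous_hasCompactSupport_mul_of_tsupport_subset contDiff_cutoff.continuous subset_rfl hb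
  h.1.integrable_of_hasCompactSupport h.2

theorem integrable_fderiv_cutoff_mul {b : R4 → ℝ} (hb : ContinuousOn b {0}ᶜ) (v : R4) :
    Integrable (fun x => fderiv ℝ (fun x : R4 => cutoff (‖x‖ ^ 2)) x v * b x) :=
  have h := continuous_hasCompactSupport_mul_of_tsupport_subset (continuous_fderiv_cutoff v)
    (tsupport_fderiv_apply_subset ℝ v) hb
  h.1.integrable_of_hasCompactSupport h.2

theorem continuousOn_fderiv_apply {V : R4 → ℝ} (hV : ContDiffOn ℝ 1 V {0}ᶜ) (v : R4) :
    ContinuousOn (fun x => fderiv ℝ V x v) {0}ᶜ :=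
  (hV.continuousOn_fderiv_of_isOpen isOpen_compl_singleton le_rfl).clm_apply continuousOn_const

theorem integral_cutoff_mul_fderiv {V : R4 → ℝ} (hV : ContDiffOn ℝ 1 V {0}ᶜ) (v : R4) :
    ∫ x, cutoff (‖x‖ ^ 2) * fderiv ℝ V x v =
      -∫ x, fderiv ℝ (fun x : R4 => cutoff (‖x‖ ^ 2)) x v * V x := by
  have hO : IsOpen ({0}ᶜ : Set R4) := isOpen_compl_singleton
  apply integral_mul_fderiv_eq_neg_fderiv_mul_of_integrable
  · exact integrable_fderiv_cutoff_mul hV.continuousOn v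
  · exact integrable_cutoff_mul (continuousOn_fderiv_apply hV v)
  · exact integrable_cutoff_mul hV.continuousOn
  · exact fun x _ => contDiff_cutoff.differentiable (by simp) x
  · intro x hx
    exact (hV.contDiffAt (hO.mem_nhds (tsupport_cutoff_subset_compl hx))).differentiableAt (by simp)

theorem fderiv_cutoff (x v : R4) :
    fderiv ℝ (fun x : R4 => cutoff (‖x‖ ^ 2)) x v = deriv cutoff (‖x‖ ^ 2) * (2 * ⟪x, v⟫_ℝ) := by
  have h1 : HasFDerivAt (fun x : R4 => ‖x‖ ^ 2) (2 • (innerSL ℝ x)) x :=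
    (hasStrictFDerivAt_norm_sq x).hasFDerivAt
  have h2 : HasDerivAt cutoff (deriv cutoff (‖x‖ ^ 2)) (‖x‖ ^ 2) :=
    ((cutoff.contDiff (n := 1)).differentiable (by simp) _).hasDerivAt
  have h3 : HasFDerivAt (fun x : R4 => cutoff (‖x‖ ^ 2)) _ x :=
    HasDerivAt.comp_hasFDerivAt (f := fun x : R4 => ‖x‖ ^ 2) (h₂ := cutoff) x h2 h1
  rw [h3.fderiv]
  simp

theorem sum_inner_mul (x : R4) (L : R4 →L[ℝ] ℝ) : ∑ i, ⟪x, e i⟫_ℝ * L (e i) = L x := by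
  conv_rhs => rw [← (EuclideanSpace.basisFun (Fin 4) ℝ).sum_repr' x]
  simp [real_inner_comm]

/-- The comparison function ‖x‖⁻² shows that the radial factor in `integral_polar` is nonzero,
without computing it. -/
theorem integral_radial_pos :
    0 < ∫ x : R4, cutoff (‖x‖ ^ 2) * (‖x‖ ^ 2)⁻¹ := by
  have hb : ContinuousOn (fun x : R4 => (‖x‖ ^ 2)⁻¹) {0}ᶜ := by
    apply ContinuousOn.inv₀ (by fun_prop)
    intro x hx
    exact pow_ne_zero 2 (norm_ne_zero_iff.2 hx)
  have h := continuous_hasCompactSupport_mul_of_tsupport_subset contDiff_cutoff.continuous subset_rfl hb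
  apply h.1.integral_pos_of_hasCompactSupport_nonneg_nonzero h.2 (x := e 0)
  · intro x
    exact mul_nonneg cutoff.nonneg (by positivity)
  · have h1 : cutoff (1 : ℝ) = 1 := cutoff.one_of_mem_closedBall (by simp [cutoff])
    simp [h1]

/-- Degree -2 is the homogeneity of the Laplacian of a degree 0 function. The integral over ℝ⁴
splits into the sphere integral times a radial factor, which can be cancelled. -/
theorem integral_sphere_eq_zero_of_integral_cutoff {w : R4 → ℝ}
    (hw : ∀ (r : ℝ) (p : S3), 0 < r → w (r • (p : R4)) = (r ^ 2)⁻¹ * w p)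
    (h : ∫ x : R4, cutoff (‖x‖ ^ 2) * w x = 0) : ∫ p : S3, w p ∂sphereMeasure = 0 := by
  have h1 := integral_radial_pos
  rw [integral_polar (fun r => cutoff (r ^ 2)) (fun x => (‖x‖ ^ 2)⁻¹)
    (by intro r p hr; simp [norm_smul])] at h1
  rw [integral_polar (fun r => cutoff (r ^ 2)) w hw] at h
  rcases mul_eq_zero.1 h with h | h
  · exact h
  · rw [h, mul_zero] at h1
    exact absurd h1 (lt_irrefl _)

theorem contDiffOn_homExt_one {f : S3 → ℝ} (hf : SmoothS f) : ContDiffOn ℝ 1 (homExt f) {0}ᶜ :=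
  fun _ hx => (hf.contDiffAt_nat hx 1).contDiffWithinAt

theorem contDiffOn_fderiv_homExt {f : S3 → ℝ} (hf : SmoothS f) (v : R4) :
    ContDiffOn ℝ 1 (fun x => fderiv ℝ (homExt f) x v) {0}ᶜ :=
  fun _ hx => (((hf.contDiffAt_nat hx 2).fderiv_right (m := 1) (by norm_num)).clm_apply
    contDiffAt_const).contDiffWithinAt

theorem integrable_sphere {f : S3 → ℝ} (hf : Continuous f) : Integrable f sphereMeasure :=
  hf.integrable_of_hasCompactSupport (HasCompactSupport.of_compactSpace f)

/-- Green's second identity: fΔg - gΔf is the divergence of V = f∇g - g∇f. Integrating by parts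
against the cutoff leaves V paired with a radial gradient, and this is zero because V is tangential.
-/
theorem integral_mul_sphereLaplacian_comm {f g : S3 → ℝ} (hf : SmoothS f) (hg : SmoothS g) :
    ∫ p, f p * sphereLaplacian g p ∂sphereMeasure =
      ∫ p, sphereLaplacian f p * g p ∂sphereMeasure := by
  have hO : IsOpen ({0}ᶜ : Set R4) := isOpen_compl_singleton
  have hd : ∀ {h : R4 → ℝ} {x : R4}, ContDiffOn ℝ 1 h {0}ᶜ → x ≠ 0 → DifferentiableAt ℝ h x :=
    fun hh hx => (hh.contDiffAt (hO.mem_nhds hx)).differentiableAt (by simp)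
  let V : Fin 4 → R4 → ℝ := fun i x =>
    homExt f x * fderiv ℝ (homExt g) x (e i) - homExt g x * fderiv ℝ (homExt f) x (e i)
  have hV : ∀ i, ContDiffOn ℝ 1 (V i) {0}ᶜ := fun i =>
    ((contDiffOn_homExt_one hf).mul (contDiffOn_fderiv_homExt hg _)).sub
      ((contDiffOn_homExt_one hg).mul (contDiffOn_fderiv_homExt hf _))
  let w : R4 → ℝ := fun x => homExt f x * (Δ (homExt g)) x - homExt g x * (Δ (homExt f)) x
  have hdiv : ∀ x : R4, x ≠ 0 → ∑ i, fderiv ℝ (V i) x (e i) = w x := by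
    intro x hx
    simp only [w]
    rw [laplacian_eq_sum_fderiv (hf.contDiffAt_nat hx 2),
      laplacian_eq_sum_fderiv (hg.contDiffAt_nat hx 2), Finset.mul_sum, Finset.mul_sum,
      ← Finset.sum_sub_distrib]
    refine Finset.sum_congr rfl fun i _ => ?_
    have h1 := hd (contDiffOn_homExt_one hf) hx
    have h2 := hd (contDiffOn_homExt_one hg) hx
    have h3 := hd (contDiffOn_fderiv_homExt hf (e i)) hx
    have h4 := hd (contDiffOn_fderiv_homExt hg (e i)) hx
    have h5 : HasFDerivAt (V i) _ x :=
      (h1.hasFDerivAt.mul h4.hasFDerivAt).sub (h2.hasFDerivAt.mul h3.hasFDerivAt)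
    rw [h5.fderiv]
    simp
    ring
  have hrad : ∀ x : R4,
      ∑ i, fderiv ℝ (fun x : R4 => cutoff (‖x‖ ^ 2)) x (e i) * V i x = 0 := by
    intro x
    by_cases hx : x = 0
    · simp [fderiv_cutoff, hx]
    · have h1 := sum_inner_mul x (fderiv ℝ (homExt g) x)
      have h2 := sum_inner_mul x (fderiv ℝ (homExt f) x)
      rw [fderiv_homExt_self hg hx] at h1
      rw [fderiv_homExt_self hf hx] at h2
      calc _ = 2 * deriv cutoff (‖x‖ ^ 2) *
            (homExt f x * ∑ i, ⟪x, e i⟫_ℝ * fderiv ℝ (homExt g) x (e i) -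
              homExt g x * ∑ i, ⟪x, e i⟫_ℝ * fderiv ℝ (homExt f) x (e i)) := by
            rw [Finset.mul_sum, Finset.mul_sum, ← Finset.sum_sub_distrib, Finset.mul_sum]
            refine Finset.sum_congr rfl fun i _ => ?_
            rw [fderiv_cutoff]
            simp only [V]
            ring
        _ = 0 := by rw [h1, h2]; ring
  have hint : ∫ x : R4, cutoff (‖x‖ ^ 2) * w x = 0 := by
    calc _ = ∫ x : R4, ∑ i, cutoff (‖x‖ ^ 2) * fderiv ℝ (V i) x (e i) := by
          refine integral_congr_ae (.of_forall fun x => ?_)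
          by_cases hx : x = 0
          · have h0 : cutoff ((0 : ℝ)) = 0 := cutoff.zero_of_le_dist (by norm_num [cutoff])
            simp [hx, h0]
          · simp only [← Finset.mul_sum, hdiv x hx]
      _ = -∫ x : R4, ∑ i, fderiv ℝ (fun x : R4 => cutoff (‖x‖ ^ 2)) x (e i) * V i x := by
          rw [integral_finsetSum _ fun i _ =>
              integrable_cutoff_mul (continuousOn_fderiv_apply (hV i) _),
            integral_finsetSum _ fun i _ => integrable_fderiv_cutoff_mul (hV i).continuousOn _,
            ← Finset.sum_neg_distrib]
          exact Finset.sum_congr rfl fun i _ => integral_cutoff_mul_fderiv (hV i) _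
      _ = 0 := by simp only [hrad, integral_zero, neg_zero]
  have hS := integral_sphere_eq_zero_of_integral_cutoff (w := w) (by
    intro r p hr
    have hp := coe_ne_zero p
    simp only [w, homExt_smul _ hr, laplacian_homExt_smul hf hr hp, laplacian_homExt_smul hg hr hp]
    ring) hint
  simp only [w, homExt_coe] at hS
  change ∫ p, (f p * sphereLaplacian g p - g p * sphereLaplacian f p) ∂sphereMeasure = 0 at hS
  rw [integral_sub] at hS
  · rw [sub_eq_zero.1 hS]
    exact integral_congr_ae (.of_forall fun p => mul_comm _ _)
  · exact integrable_sphere (hf.continuous.mul hg.sphereLaplacian.continuous)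
  · exact integrable_sphere (hg.continuous.mul hf.sphereLaplacian.continuous)

theorem integral_sphereLaplacian {f : S3 → ℝ} (hf : SmoothS f) :
    ∫ p, sphereLaplacian f p ∂sphereMeasure = 0 := by
  have h := integral_mul_sphereLaplacian_comm hf (smoothS_const 1)
  simpa [sphereLaplacian_const] using h.symm

theorem SmoothS.paneitz {f : S3 → ℝ} (hf : SmoothS f) : SmoothS (paneitz f) := by
  have h := (hf.sphereLaplacian.sphereLaplacian.add (hf.sphereLaplacian.const_mul (1 / 2))).add
    (hf.const_mul (-(15 / 16)))
  convert h using 2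
  simp only [PaneitzSphere.paneitz]
  ring

theorem integral_mul_paneitz_comm {f g : S3 → ℝ} (hf : SmoothS f) (hg : SmoothS g) :
    ∫ p, f p * paneitz g p ∂sphereMeasure = ∫ p, paneitz f p * g p ∂sphereMeasure := by
  have hc := hf.continuous
  have hc1 := hf.sphereLaplacian.continuous
  have hc2 := hf.sphereLaplacian.sphereLaplacian.continuous
  have gc := hg.continuous
  have gc1 := hg.sphereLaplacian.continuous
  have gc2 := hg.sphereLaplacian.sphereLaplacian.continuous
  have h1 := integral_mul_sphereLaplacian_comm hf hg
  have h2 : ∫ p, f p * sphereLaplacian (sphereLaplacian g) p ∂sphereMeasure =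
      ∫ p, sphereLaplacian (sphereLaplacian f) p * g p ∂sphereMeasure := by
    rw [integral_mul_sphereLaplacian_comm hf hg.sphereLaplacian,
      integral_mul_sphereLaplacian_comm hf.sphereLaplacian hg]
  have e1 : ∀ p, f p * paneitz g p = f p * sphereLaplacian (sphereLaplacian g) p +
      (1 / 2) * (f p * sphereLaplacian g p) - 15 / 16 * (f p * g p) := by
    intro p; simp only [paneitz]; ring
  have e2 : ∀ p, paneitz f p * g p = sphereLaplacian (sphereLaplacian f) p * g p +
      (1 / 2) * (sphereLaplacian f p * g p) - 15 / 16 * (f p * g p) := by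
    intro p; simp only [paneitz]; ring
  simp only [e1, e2]
  rw [integral_sub (integrable_sphere (by fun_prop)) (integrable_sphere (by fun_prop)),
    integral_sub (integrable_sphere (by fun_prop)) (integrable_sphere (by fun_prop)),
    integral_add (integrable_sphere (by fun_prop)) (integrable_sphere (by fun_prop)),
    integral_add (integrable_sphere (by fun_prop)) (integrable_sphere (by fun_prop)),
    integral_const_mul, integral_const_mul, integral_const_mul, h1, h2]

/-! ### Zonal functions -/

theorem inner_mem_Icc (a p : S3) : ⟪(a : R4), (p : R4)⟫_ℝ ∈ Icc (-1 : ℝ) 1 := by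
  have h := abs_real_inner_le_norm (a : R4) (p : R4)
  rw [norm_coe, norm_coe, one_mul] at h
  exact abs_le.1 h

theorem hasFDerivAt_inv_norm {x : R4} (hx : x ≠ 0) :
    HasFDerivAt (fun x : R4 => ‖x‖⁻¹) (-(‖x‖⁻¹ ^ 3) • innerSL ℝ x) x := by
  have hn : ‖x‖ ≠ 0 := norm_ne_zero_iff.2 hx
  have h1 : HasFDerivAt (fun x : R4 => ‖x‖ ^ 2) (2 • (innerSL ℝ x)) x :=
    (hasStrictFDerivAt_norm_sq x).hasFDerivAt
  have h2 := h1.sqrt (pow_ne_zero 2 hn)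
  simp only [Real.sqrt_sq (norm_nonneg _)] at h2
  have h3 := (hasDerivAt_inv hn).comp_hasFDerivAt x h2
  refine h3.congr_fderiv ?_
  ext v
  simp
  field_simp

theorem homExt_zonal (F : ℝ → ℝ) (a : S3) {x : R4} (hx : x ≠ 0) :
    homExt (fun y : S3 => F ⟪(a : R4), (y : R4)⟫_ℝ) x = F (⟪(a : R4), x⟫_ℝ * ‖x‖⁻¹) := by
  rw [homExt_of_ne hx]
  simp only [toS3, inner_smul_right]
  rw [mul_comm]

theorem inner_mul_inv_norm_mem (a : S3) {x : R4} (hx : x ≠ 0) :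
    ⟪(a : R4), x⟫_ℝ * ‖x‖⁻¹ ∈ Icc (-1 : ℝ) 1 := by
  have h := inner_mem_Icc a (toS3 x hx)
  simp only [toS3, inner_smul_right] at h
  rwa [mul_comm]

theorem hasFDerivAt_inner_mul_inv_norm (a : S3) {x : R4} (hx : x ≠ 0) :
    HasFDerivAt (fun x : R4 => ⟪(a : R4), x⟫_ℝ * ‖x‖⁻¹)
      (⟪(a : R4), x⟫_ℝ • (-(‖x‖⁻¹ ^ 3) • innerSL ℝ x) + ‖x‖⁻¹ • innerSL ℝ (a : R4)) x := by
  have h1 : HasFDerivAt (fun x : R4 => ⟪(a : R4), x⟫_ℝ) (innerSL ℝ (a : R4)) x :=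
    (innerSL ℝ (a : R4)).hasFDerivAt
  exact h1.mul (hasFDerivAt_inv_norm hx)

theorem smoothS_zonal {F : ℝ → ℝ} {U : Set ℝ} (hU : IsOpen U) (hI : Icc (-1 : ℝ) 1 ⊆ U)
    (hF : ContDiffOn ℝ ∞ F U) (a : S3) :
    SmoothS (fun y : S3 => F ⟪(a : R4), (y : R4)⟫_ℝ) := by
  have h1 : ContDiffOn ℝ ∞ (fun x : R4 => F (⟪(a : R4), x⟫_ℝ * ‖x‖⁻¹)) {0}ᶜ := by
    intro x hx
    have h2 := hF.contDiffAt (hU.mem_nhds (hI (inner_mul_inv_norm_mem a hx)))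
    have h3 : ContDiffAt ℝ ∞ (fun x : R4 => ⟪(a : R4), x⟫_ℝ * ‖x‖⁻¹) x :=
      (contDiffAt_const.inner ℝ contDiffAt_id).mul
        ((contDiffAt_norm ℝ hx).inv (norm_ne_zero_iff.2 hx))
    exact (h2.comp x h3).contDiffWithinAt
  exact h1.congr fun x hx => homExt_zonal F a hx

/-- Chain rule for t(x) = (a·x)/‖x‖: at a point of the sphere its gradient is a - tp, of squared
length 1 - t², and its Laplacian is -3t. -/
theorem sphereLaplacian_zonal {F F₁ F₂ : ℝ → ℝ} {U : Set ℝ} (hU : IsOpen U)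
    (hI : Icc (-1 : ℝ) 1 ⊆ U) (hF : ContDiffOn ℝ ∞ F U) (h₁ : ∀ t ∈ U, HasDerivAt F (F₁ t) t)
    (h₂ : ∀ t ∈ U, HasDerivAt F₁ (F₂ t) t) (a p : S3) :
    sphereLaplacian (fun y : S3 => F ⟪(a : R4), (y : R4)⟫_ℝ) p =
      (1 - ⟪(a : R4), (p : R4)⟫_ℝ ^ 2) * F₂ ⟪(a : R4), (p : R4)⟫_ℝ -
        3 * ⟪(a : R4), (p : R4)⟫_ℝ * F₁ ⟪(a : R4), (p : R4)⟫_ℝ := by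
  have hp := coe_ne_zero p
  set t := ⟪(a : R4), (p : R4)⟫_ℝ with ht
  have hS := smoothS_zonal hU hI hF a
  rw [sphereLaplacian, laplacian_eq_sum_fderiv (hS.contDiffAt_nat hp 2)]
  -- The pure second derivative in direction i: the coefficient of F'' is (∂ᵢt)², that of F' is
  -- ∂ᵢ²t.
  have key : ∀ i, fderiv ℝ (fun y => fderiv ℝ
      (homExt (fun y : S3 => F ⟪(a : R4), (y : R4)⟫_ℝ)) y (e i)) p (e i) =
      F₂ t * ((a : R4) i - t * (p : R4) i) ^ 2 +
        F₁ t * (-2 * ((a : R4) i * (p : R4) i) - t + 3 * t * (p : R4) i ^ 2) := by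
    intro i
    have hinner : ∀ x : R4, ⟪x, e i⟫_ℝ = x i := by
      intro x; simp [EuclideanSpace.inner_single_right]
    have hne : ∀ᶠ x : R4 in 𝓝 (p : R4), x ≠ 0 := isOpen_compl_singleton.mem_nhds hp
    have e1 : (fun y => fderiv ℝ (homExt (fun y : S3 => F ⟪(a : R4), (y : R4)⟫_ℝ)) y (e i))
        =ᶠ[𝓝 (p : R4)] fun x => F₁ (⟪(a : R4), x⟫_ℝ * ‖x‖⁻¹) *
          (⟪(a : R4), x⟫_ℝ * (-(‖x‖⁻¹ ^ 3) * ⟪x, e i⟫_ℝ) + ‖x‖⁻¹ * (a : R4) i) := by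
      filter_upwards [hne] with x hx
      have e2 : homExt (fun y : S3 => F ⟪(a : R4), (y : R4)⟫_ℝ) =ᶠ[𝓝 x]
          fun x => F (⟪(a : R4), x⟫_ℝ * ‖x‖⁻¹) := by
        filter_upwards [isOpen_compl_singleton.mem_nhds hx] with z hz using homExt_zonal F a hz
      have e3 : HasFDerivAt (fun x : R4 => F (⟪(a : R4), x⟫_ℝ * ‖x‖⁻¹)) _ x :=
        (h₁ _ (hI (inner_mul_inv_norm_mem a hx))).comp_hasFDerivAt x
          (hasFDerivAt_inner_mul_inv_norm a hx)
      rw [e2.fderiv_eq, e3.fderiv]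
      simp only [smul_apply, add_apply, innerSL_apply_apply, smul_eq_mul, hinner]
    rw [e1.fderiv_eq]
    have hM := hasFDerivAt_inv_norm hp
    have hA : HasFDerivAt (fun x : R4 => ⟪(a : R4), x⟫_ℝ) (innerSL ℝ (a : R4)) (p : R4) :=
      (innerSL ℝ (a : R4)).hasFDerivAt
    have hX : HasFDerivAt (fun x : R4 => ⟪x, e i⟫_ℝ) (innerSL ℝ (e i)) (p : R4) := by
      have := (innerSL ℝ (e i)).hasFDerivAt (x := (p : R4))
      refine this.congr_of_eventuallyEq (.of_forall fun x => ?_)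
      exact real_inner_comm _ _
    have hF1 : HasFDerivAt (fun x : R4 => F₁ (⟪(a : R4), x⟫_ℝ * ‖x‖⁻¹)) _ (p : R4) :=
      (h₂ _ (hI (inner_mul_inv_norm_mem a hp))).comp_hasFDerivAt (p : R4)
        (hasFDerivAt_inner_mul_inv_norm a hp)
    have hG : HasFDerivAt (fun x => F₁ (⟪(a : R4), x⟫_ℝ * ‖x‖⁻¹) *
          (⟪(a : R4), x⟫_ℝ * (-(‖x‖⁻¹ ^ 3) * ⟪x, e i⟫_ℝ) + ‖x‖⁻¹ * (a : R4) i)) _ (p : R4) :=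
      hF1.mul ((hA.mul ((hM.pow 3).neg.mul hX)).add (hM.mul_const ((a : R4) i)))
    rw [hG.fderiv]
    have hnorm := norm_coe p
    simp only [smul_apply, add_apply, neg_apply, innerSL_apply_apply, smul_eq_mul, hinner,
      hnorm, ← ht]
    have hei : (e i : R4) i = 1 := by simp
    simp only [hei]
    norm_num
    ring
  rw [Finset.sum_congr rfl fun i _ => key i]
  have s1 : ∑ i, (a : R4) i ^ 2 = 1 := by rw [sum_sq_eq, norm_coe]; norm_num
  have s2 : ∑ i, (p : R4) i ^ 2 = 1 := by rw [sum_sq_eq, norm_coe]; norm_num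
  have s3 : ∑ i, (a : R4) i * (p : R4) i = t := by
    rw [ht, PiLp.inner_apply]
    exact Finset.sum_congr rfl fun i _ => by simp [mul_comm]
  simp only [Fin.sum_univ_four] at s1 s2 s3 ⊢
  linear_combination F₂ t * s1 + (F₂ t * t ^ 2 + 3 * t * F₁ t) * s2 -
    (2 * t * F₂ t + 2 * F₁ t) * s3

/-- The zonal function `y ↦ (c - a · y) ^ α`. -/
def zpw (c α : ℝ) (a y : S3) : ℝ := (c - ⟪(a : R4), (y : R4)⟫_ℝ) ^ α

theorem sub_inner_pos {c : ℝ} (hc : 1 < c) (a y : S3) : 0 < c - ⟪(a : R4), (y : R4)⟫_ℝ := by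
  linarith [(inner_mem_Icc a y).2]

theorem contDiffOn_sub_rpow (c α : ℝ) : ContDiffOn ℝ ∞ (fun t : ℝ => (c - t) ^ α) (Iio c) :=
  fun _ ht => ((contDiffAt_const.sub contDiffAt_id).rpow_const_of_ne
    (sub_pos.2 ht).ne').contDiffWithinAt

theorem smoothS_zpw {c : ℝ} (hc : 1 < c) (α : ℝ) (a : S3) : SmoothS (zpw c α a) :=
  smoothS_zonal isOpen_Iio (fun _ ht => lt_of_le_of_lt ht.2 hc) (contDiffOn_sub_rpow c α) a

theorem sphereLaplacian_zpw {c : ℝ} (hc : 1 < c) (α : ℝ) (a p : S3) :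
    sphereLaplacian (zpw c α a) p = α * (α - 1) * (1 - c ^ 2) * zpw c (α - 2) a p +
      α * (2 * α + 1) * c * zpw c (α - 1) a p - α * (α + 2) * zpw c α a p := by
  have hd : ∀ β t : ℝ, t ∈ Iio c → HasDerivAt (fun t : ℝ => (c - t) ^ β)
      (-(β * (c - t) ^ (β - 1))) t := by
    intro β t ht
    have h := ((hasDerivAt_id t).const_sub c).rpow_const (p := β) (Or.inl (sub_pos.2 ht).ne')
    refine h.congr_deriv ?_
    simp
  have h := sphereLaplacian_zonal (F := fun t => (c - t) ^ α)
    (F₁ := fun t => -(α * (c - t) ^ (α - 1)))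
    (F₂ := fun t => -(α * -((α - 1) * (c - t) ^ (α - 1 - 1)))) isOpen_Iio
    (fun _ ht => lt_of_le_of_lt ht.2 hc) (contDiffOn_sub_rpow c α) (hd α)
    (fun t ht => ((hd (α - 1) t ht).const_mul α).neg) a p
  have hs := sub_inner_pos hc a p
  have h' : sphereLaplacian (zpw c α a) p = _ := h
  rw [h']
  simp only [zpw]
  set t := ⟪(a : R4), (p : R4)⟫_ℝ
  have e1 : (c - t) ^ (α - 1) = (c - t) ^ (α - 2) * (c - t) := by
    rw [← Real.rpow_add_one hs.ne']; congr 1; ring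
  have e2 : (c - t) ^ α = (c - t) ^ (α - 2) * (c - t) ^ 2 := by
    rw [← Real.rpow_natCast, ← Real.rpow_add hs]; congr 1; norm_num
  rw [e2, e1, show α - 1 - 1 = α - 2 by ring]
  ring

/-- The exponent 1/2 is special: the contributions of the powers -5/2, -3/2, -1/2 and 1/2 all
cancel, and the remaining term carries a factor that vanishes at c = 1. -/
theorem paneitz_zpw {c : ℝ} (hc : 1 < c) (a p : S3) :
    paneitz (zpw c (1 / 2) a) p = -(15 / 16 * (c ^ 2 - 1) ^ 2 * zpw c (-(7 / 2)) a p) := by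
  have h1 : sphereLaplacian (zpw c (1 / 2) a) = fun p =>
      ((c ^ 2 - 1) / 4 * zpw c (-(3 / 2)) a p + c * zpw c (-(1 / 2)) a p) +
        (-(5 / 4)) * zpw c (1 / 2) a p := by
    funext q
    rw [sphereLaplacian_zpw hc, show (1 / 2 - 2 : ℝ) = -(3 / 2) by norm_num,
      show (1 / 2 - 1 : ℝ) = -(1 / 2) by norm_num]
    ring
  have s1 := smoothS_zpw hc (-(3 / 2)) a
  have s2 := smoothS_zpw hc (-(1 / 2)) a
  have s3 := smoothS_zpw hc (1 / 2) a
  have h2 : sphereLaplacian (sphereLaplacian (zpw c (1 / 2) a)) p =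
      ((c ^ 2 - 1) / 4 * sphereLaplacian (zpw c (-(3 / 2)) a) p +
        c * sphereLaplacian (zpw c (-(1 / 2)) a) p) +
        (-(5 / 4)) * sphereLaplacian (zpw c (1 / 2) a) p := by
    conv_lhs => rw [h1]
    rw [sphereLaplacian_add ((s1.const_mul _).add (s2.const_mul _)) (s3.const_mul _),
      sphereLaplacian_add (s1.const_mul _) (s2.const_mul _), sphereLaplacian_const_mul s1,
      sphereLaplacian_const_mul s2, sphereLaplacian_const_mul s3]
  rw [paneitz, h2, sphereLaplacian_zpw hc, sphereLaplacian_zpw hc, sphereLaplacian_zpw hc,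
    show (-(3 / 2) - 2 : ℝ) = -(7 / 2) by norm_num, show (-(3 / 2) - 1 : ℝ) = -(5 / 2) by norm_num,
    show (-(1 / 2) - 2 : ℝ) = -(5 / 2) by norm_num, show (-(1 / 2) - 1 : ℝ) = -(3 / 2) by norm_num,
    show (1 / 2 - 2 : ℝ) = -(3 / 2) by norm_num, show (1 / 2 - 1 : ℝ) = -(1 / 2) by norm_num]
  ring

/-! ### Integrals of zonal functions -/

theorem sphereMeasure_real_univ : sphereMeasure.real univ = 2 * Real.pi ^ 2 := by
  rw [Measure.toSphere_real_apply_univ, Measure.real, EuclideanSpace.volume_ball]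
  have h : Real.Gamma ((4 : ℝ) / 2 + 1) = 2 := by
    have := Real.Gamma_nat_eq_factorial 2
    norm_num at this ⊢
  have h2 : √Real.pi ^ 4 = Real.pi ^ 2 := by
    rw [show 4 = 2 * 2 by norm_num, pow_mul, Real.sq_sqrt Real.pi_pos.le]
  simp [h, h2]
  rw [ENNReal.toReal_ofReal (by positivity)]
  ring

/-- The integrand is the derivative of (1 - t²)^(3/2) F₁, which vanishes at both endpoints. It is
the one-dimensional counterpart of `integral_sphereLaplacian`. -/
theorem integral_zonal_laplacian_interval {F₁ F₂ : ℝ → ℝ} (h1 : Continuous F₁)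
    (h2 : Continuous F₂) (h₂ : ∀ t, HasDerivAt F₁ (F₂ t) t) :
    ∫ t in (-1 : ℝ)..1, ((1 - t ^ 2) * F₂ t - 3 * t * F₁ t) * √(1 - t ^ 2) = 0 := by
  have h := intervalIntegral.integral_eq_sub_of_hasDerivAt_of_le (a := -1) (b := 1) (by norm_num)
    (f := fun t => (1 - t ^ 2) * √(1 - t ^ 2) * F₁ t)
    (f' := fun t => ((1 - t ^ 2) * F₂ t - 3 * t * F₁ t) * √(1 - t ^ 2))
    (by fun_prop) ?_ (Continuous.intervalIntegrable (by fun_prop) _ _)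
  · rw [h]; simp
  · intro t ht
    have hpos : 0 < 1 - t ^ 2 := by nlinarith [ht.1, ht.2]
    have d1 : HasDerivAt (fun t : ℝ => 1 - t ^ 2) (-(2 * t)) t := by
      simpa using ((hasDerivAt_id t).pow 2).const_sub 1
    have h3 : HasDerivAt (fun t => (1 - t ^ 2) * √(1 - t ^ 2) * F₁ t) _ t :=
      (d1.mul (d1.sqrt hpos.ne')).mul (h₂ t)
    refine h3.congr_deriv ?_
    have hs : √(1 - t ^ 2) ≠ 0 := (Real.sqrt_pos.2 hpos).ne'
    have hsq : √(1 - t ^ 2) ^ 2 = 1 - t ^ 2 := Real.sq_sqrt hpos.le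
    have hv : -(2 * t) / (2 * √(1 - t ^ 2)) = -t * √(1 - t ^ 2) / (1 - t ^ 2) := by
      rw [div_eq_div_iff (by positivity) hpos.ne']
      linear_combination 2 * t * hsq
    simp only [Pi.mul_apply, hv]
    field_simp
    ring

theorem continuous_inner_left (a : S3) : Continuous fun y : S3 => ⟪(a : R4), (y : R4)⟫_ℝ := by
  fun_prop

theorem hasDerivAt_monomial_two (n : ℕ) (t : ℝ) :
    HasDerivAt (fun t : ℝ => ((n : ℝ) + 2) * t ^ (n + 1)) (((n : ℝ) + 2) * ((n + 1) * t ^ n)) t := by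
  simpa using (hasDerivAt_pow (n + 1) t).const_mul ((n : ℝ) + 2)

theorem integral_inner_pow_add_two (a : S3) (n : ℕ) :
    ((n : ℝ) + 4) * ∫ y : S3, ⟪(a : R4), (y : R4)⟫_ℝ ^ (n + 2) ∂sphereMeasure =
      (n + 1) * ∫ y : S3, ⟪(a : R4), (y : R4)⟫_ℝ ^ n ∂sphereMeasure := by
  have hc := continuous_inner_left a
  have h := integral_sphereLaplacian (smoothS_zonal isOpen_univ (subset_univ _)
    (contDiff_id.pow (n + 2)).contDiffOn a)
  have hL := sphereLaplacian_zonal (F := fun t => t ^ (n + 2)) isOpen_univ (subset_univ _)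
    (contDiff_id.pow (n + 2)).contDiffOn
    (fun t _ => by simpa using hasDerivAt_pow (n + 2) t)
    (fun t _ => hasDerivAt_monomial_two n t) a
  have e1 : ∀ p : S3, sphereLaplacian (fun y : S3 => ⟪(a : R4), (y : R4)⟫_ℝ ^ (n + 2)) p =
      ((n : ℝ) + 2) * ((n + 1) * ⟪(a : R4), (p : R4)⟫_ℝ ^ n) -
      ((n : ℝ) + 2) * ((n + 4) * ⟪(a : R4), (p : R4)⟫_ℝ ^ (n + 2)) := by
    intro p
    rw [hL p]
    ring
  have h' : ∫ p, sphereLaplacian (fun y : S3 => ⟪(a : R4), (y : R4)⟫_ℝ ^ (n + 2)) p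
    ∂sphereMeasure = 0 := h
  simp only [e1] at h'
  rw [integral_sub (integrable_sphere (by fun_prop)) (integrable_sphere (by fun_prop)),
    integral_const_mul, integral_const_mul, integral_const_mul, integral_const_mul] at h'
  have hn : ((n : ℝ) + 2) ≠ 0 := by positivity
  apply mul_left_cancel₀ hn
  linarith

theorem integral_interval_pow_add_two (n : ℕ) :
    ((n : ℝ) + 4) * ∫ t in (-1 : ℝ)..1, t ^ (n + 2) * √(1 - t ^ 2) =
      (n + 1) * ∫ t in (-1 : ℝ)..1, t ^ n * √(1 - t ^ 2) := by
  have h := integral_zonal_laplacian_interval (by fun_prop) (by fun_prop)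
    (hasDerivAt_monomial_two n)
  have e1 : ∀ t : ℝ, ((1 - t ^ 2) * (((n : ℝ) + 2) * ((n + 1) * t ^ n)) -
      3 * t * (((n : ℝ) + 2) * t ^ (n + 1))) * √(1 - t ^ 2) =
      ((n : ℝ) + 2) * ((n + 1) * (t ^ n * √(1 - t ^ 2))) -
      ((n : ℝ) + 2) * ((n + 4) * (t ^ (n + 2) * √(1 - t ^ 2))) := by
    intro t; ring
  simp only [e1] at h
  rw [intervalIntegral.integral_sub (Continuous.intervalIntegrable (by fun_prop) _ _)
    (Continuous.intervalIntegrable (by fun_prop) _ _), intervalIntegral.integral_const_mul,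
    intervalIntegral.integral_const_mul, intervalIntegral.integral_const_mul,
    intervalIntegral.integral_const_mul] at h
  have hn : ((n : ℝ) + 2) ≠ 0 := by positivity
  apply mul_left_cancel₀ hn
  linarith

/-- Both sides satisfy the same two-step recursion in n, because both functionals annihilate the
zonal Laplacian of t^(n+2). The moments of order 0 and 1 agree directly. -/
theorem integral_inner_pow (a : S3) (n : ℕ) :
    ∫ y : S3, ⟪(a : R4), (y : R4)⟫_ℝ ^ n ∂sphereMeasure =
      4 * Real.pi * ∫ t in (-1 : ℝ)..1, t ^ n * √(1 - t ^ 2) := by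
  induction n using Nat.twoStepInduction with
  | zero =>
    simp only [pow_zero, one_mul, integral_const, smul_eq_mul, mul_one, integral_sqrt_one_sub_sq,
      sphereMeasure_real_univ]
    ring
  | one =>
    have h1 : ∫ y : S3, ⟪(a : R4), (y : R4)⟫_ℝ ∂sphereMeasure = 0 := by
      have h := integral_sphereLaplacian (smoothS_zonal isOpen_univ (subset_univ _)
        contDiff_id.contDiffOn a)
      have hL := sphereLaplacian_zonal (F := id) (F₁ := fun _ => 1) (F₂ := fun _ => 0) isOpen_univ
        (subset_univ _) contDiff_id.contDiffOn (fun t _ => hasDerivAt_id t)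
        (fun t _ => hasDerivAt_const t 1) a
      simp only [hL, mul_zero, mul_one, zero_sub, integral_neg, integral_const_mul] at h
      linarith
    have h2 := integral_zonal_laplacian_interval (F₁ := fun _ => 1) (F₂ := fun _ => 0)
      (by fun_prop) (by fun_prop) (fun t => hasDerivAt_const t 1)
    have e1 : ∀ t : ℝ, ((1 - t ^ 2) * 0 - 3 * t * 1) * √(1 - t ^ 2) =
      -3 * (t * √(1 - t ^ 2)) := by intro t; ring
    simp only [e1, intervalIntegral.integral_const_mul] at h2
    simp only [pow_one, h1]
    have h3 : ∫ t in (-1 : ℝ)..1, t * √(1 - t ^ 2) = 0 := by linarith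
    rw [h3, mul_zero]
  | more n ih _ =>
    have hn : ((n : ℝ) + 4) ≠ 0 := by positivity
    apply mul_left_cancel₀ hn
    rw [integral_inner_pow_add_two, ih]
    linear_combination (-(4 * Real.pi)) * integral_interval_pow_add_two n

theorem integral_zonal_polynomial (a : S3) (q : Polynomial ℝ) :
    ∫ y : S3, q.eval ⟪(a : R4), (y : R4)⟫_ℝ ∂sphereMeasure =
      4 * Real.pi * ∫ t in (-1 : ℝ)..1, q.eval t * √(1 - t ^ 2) := by
  have hc := continuous_inner_left a
  induction q using Polynomial.induction_on' with
  | add p q hp hq =>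
    simp only [Polynomial.eval_add, add_mul]
    rw [integral_add (integrable_sphere (by fun_prop)) (integrable_sphere (by fun_prop)),
      intervalIntegral.integral_add (Continuous.intervalIntegrable (by fun_prop) _ _)
        (Continuous.intervalIntegrable (by fun_prop) _ _), hp, hq]
    ring
  | monomial n c =>
    simp only [Polynomial.eval_monomial, mul_assoc]
    rw [integral_const_mul, intervalIntegral.integral_const_mul, integral_inner_pow]
    ring

/-- Weierstrass approximation extends the identity from polynomials: both sides are continuous for
the sup norm on [-1, 1]. -/
theorem integral_zonal (a : S3) {f : ℝ → ℝ} (hf : Continuous f) :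
    ∫ y : S3, f ⟪(a : R4), (y : R4)⟫_ℝ ∂sphereMeasure =
      4 * Real.pi * ∫ t in (-1 : ℝ)..1, f t * √(1 - t ^ 2) := by
  have hc := continuous_inner_left a
  set D := ∫ y : S3, f ⟪(a : R4), (y : R4)⟫_ℝ ∂sphereMeasure -
      4 * Real.pi * ∫ t in (-1 : ℝ)..1, f t * √(1 - t ^ 2) with hD
  suffices D = 0 by linarith
  have key : ∀ δ > 0, |D| ≤ δ * (2 * Real.pi ^ 2 + 8 * Real.pi) := by
    intro δ hδ
    obtain ⟨q, hq⟩ := exists_polynomial_near_of_continuousOn (-1) 1 f hf.continuousOn δ hδ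
    have hq' := integral_zonal_polynomial a q
    have b1 : |∫ y : S3, (q.eval ⟪(a : R4), (y : R4)⟫_ℝ - f ⟪(a : R4), (y : R4)⟫_ℝ)
        ∂sphereMeasure| ≤ δ * (2 * Real.pi ^ 2) := by
      rw [← sphereMeasure_real_univ]
      exact norm_integral_le_of_norm_le_const 
        (.of_forall fun y => (Real.norm_eq_abs _).trans_le (hq _ (inner_mem_Icc a y)).le)
    have b2 : |∫ t in (-1 : ℝ)..1, (q.eval t * √(1 - t ^ 2) - f t * √(1 - t ^ 2))| ≤ δ * 2 := by
      have h := intervalIntegral.norm_integral_le_of_norm_le_const (a := (-1 : ℝ)) (b := 1)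
        (f := fun t => q.eval t * √(1 - t ^ 2) - f t * √(1 - t ^ 2)) (C := δ) ?_
      · norm_num at h ⊢
        exact h
      · intro t ht
        rw [uIoc_of_le (by norm_num)] at ht
        rw [← sub_mul, norm_mul, Real.norm_eq_abs, Real.norm_eq_abs,
          abs_of_nonneg (Real.sqrt_nonneg _)]
        have h1 := (hq t ⟨ht.1.le, ht.2⟩).le
        have h2 : √(1 - t ^ 2) ≤ 1 := Real.sqrt_le_one.2 (by nlinarith [sq_nonneg t])
        calc _ ≤ δ * 1 := mul_le_mul h1 h2 (Real.sqrt_nonneg _) hδ.le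
          _ = δ := mul_one δ
    rw [integral_sub (integrable_sphere (by fun_prop)) (integrable_sphere (by fun_prop)),
      hq'] at b1
    rw [intervalIntegral.integral_sub (Continuous.intervalIntegrable (by fun_prop) _ _)
      (Continuous.intervalIntegrable (by fun_prop) _ _)] at b2
    rw [abs_le] at b1 b2 ⊢
    have hpi := Real.pi_pos
    constructor <;> nlinarith
  have hlim : Tendsto (fun δ : ℝ => δ * (2 * Real.pi ^ 2 + 8 * Real.pi)) (𝓝[>] 0) (𝓝 0) := by
    have : Continuous (fun δ : ℝ => δ * (2 * Real.pi ^ 2 + 8 * Real.pi)) := by fun_prop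
    simpa using (this.tendsto 0).mono_left nhdsWithin_le_nhds
  have := ge_of_tendsto hlim (eventually_nhdsWithin_of_forall fun δ hδ => key δ hδ)
  exact abs_eq_zero.1 (le_antisymm this (abs_nonneg _))

theorem integral_one_sub_mul_sqrt_one_add :
    ∫ t in (-1 : ℝ)..1, (1 - t) * √(1 + t) = 16 * √2 / 15 := by
  -- With u = 1 + t the integrand is (2 - u)√u, whose antiderivative is (4/3)u^(3/2) - (2/5)u^(5/2).
  have h := intervalIntegral.integral_eq_sub_of_hasDerivAt_of_le (a := -1) (b := 1) (by norm_num)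
    (f := fun t => (4 / 3 * (1 + t) - 2 / 5 * (1 + t) ^ 2) * √(1 + t))
    (f' := fun t => (1 - t) * √(1 + t))
    (by fun_prop) ?_ (Continuous.intervalIntegrable (by fun_prop) _ _)
  · rw [h]
    norm_num
    ring
  · intro t ht
    have hpos : 0 < 1 + t := by linarith [ht.1]
    have d1 : HasDerivAt (fun t : ℝ => 1 + t) 1 t := (hasDerivAt_id t).const_add 1
    have h3 : HasDerivAt (fun t => (4 / 3 * (1 + t) - 2 / 5 * (1 + t) ^ 2) * √(1 + t)) _ t :=
      ((d1.const_mul (4 / 3 : ℝ)).sub ((d1.pow 2).const_mul (2 / 5 : ℝ))).mul (d1.sqrt hpos.ne')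
    refine h3.congr_deriv ?_
    have hs : √(1 + t) ≠ 0 := (Real.sqrt_pos.2 hpos).ne'
    have hsq : √(1 + t) ^ 2 = 1 + t := Real.sq_sqrt hpos.le
    have hv : 1 / (2 * √(1 + t)) = √(1 + t) / (2 * (1 + t)) := by
      rw [div_eq_div_iff (by positivity) (by positivity)]
      linear_combination -2 * hsq
    simp only [Pi.sub_apply, Pi.pow_apply, hv]
    field_simp
    push_cast
    ring

theorem integral_sqrt_one_sub_inner (a : S3) :
    ∫ y : S3, √(1 - ⟪(a : R4), (y : R4)⟫_ℝ) ∂sphereMeasure = 64 * √2 * Real.pi / 15 := by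
  rw [integral_zonal a (f := fun t => √(1 - t)) (by fun_prop)]
  have h : ∫ t in (-1 : ℝ)..1, √(1 - t) * √(1 - t ^ 2) = ∫ t in (-1 : ℝ)..1, (1 - t) * √(1 + t) := by
    apply intervalIntegral.integral_congr
    intro t ht
    rw [uIcc_of_le (by norm_num)] at ht
    have h1 : 0 ≤ 1 - t := by linarith [ht.2]
    simp only
    rw [show 1 - t ^ 2 = (1 - t) * (1 + t) by ring, Real.sqrt_mul h1, ← mul_assoc,
      Real.mul_self_sqrt h1]
  rw [h, integral_one_sub_mul_sqrt_one_add]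
  ring

/-! ### The fundamental solution of the Paneitz operator -/

theorem zpw_half (c : ℝ) (a y : S3) : zpw c (1 / 2) a y = √(c - ⟪(a : R4), (y : R4)⟫_ℝ) := by
  rw [zpw, Real.sqrt_eq_rpow]

theorem tendsto_integral_zpw_half_mul (a : S3) {h : S3 → ℝ} (hh : Continuous h) :
    Tendsto (fun c => ∫ y, zpw c (1 / 2) a y * h y ∂sphereMeasure) (𝓝[>] 1)
      (𝓝 (∫ y : S3, √(1 - ⟪(a : R4), (y : R4)⟫_ℝ) * h y ∂sphereMeasure)) := by
  have hc : Continuous fun c : ℝ => ∫ y : S3, √(c - ⟪(a : R4), (y : R4)⟫_ℝ) * h y ∂sphereMeasure := by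
    have := continuous_parametric_integral_of_continuous (μ := sphereMeasure)
      (f := fun (c : ℝ) (y : S3) => √(c - ⟪(a : R4), (y : R4)⟫_ℝ) * h y)
      (by unfold Function.uncurry; fun_prop) isCompact_univ
    simpa using this
  simp only [zpw_half]
  exact (hc.tendsto 1).mono_left nhdsWithin_le_nhds

/-- The function `-P √(c - a · y)`, an approximate identity as `c ↓ 1`. -/
def peak (c : ℝ) (a y : S3) : ℝ := 15 / 16 * (c ^ 2 - 1) ^ 2 * zpw c (-(7 / 2)) a y

theorem smoothS_peak {c : ℝ} (hc : 1 < c) (a : S3) : SmoothS (peak c a) :=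
  (smoothS_zpw hc _ a).const_mul _

theorem paneitz_zpw_half {c : ℝ} (hc : 1 < c) (a : S3) :
    paneitz (zpw c (1 / 2) a) = fun p => -peak c a p := funext fun p => paneitz_zpw hc a p

theorem paneitz_one (p : S3) : paneitz (fun _ => 1) p = -(15 / 16) := by
  have h : sphereLaplacian (fun _ => (1 : ℝ)) = fun _ => 0 :=
    funext fun q => sphereLaplacian_const 1 q
  rw [paneitz, h, sphereLaplacian_const]
  ring

theorem integral_zpw_half_mul_paneitz {c : ℝ} (hc : 1 < c) (a : S3) {φ : S3 → ℝ} (hφ : SmoothS φ) :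
    ∫ y, zpw c (1 / 2) a y * paneitz φ y ∂sphereMeasure =
      -∫ y, peak c a y * φ y ∂sphereMeasure := by
  rw [integral_mul_paneitz_comm (smoothS_zpw hc _ a) hφ, paneitz_zpw_half hc, ← integral_neg]
  simp only [neg_mul]

/-- The mass is found by testing symmetry against φ = 1: P1 = -15/16, so the limit is 15/16 · ∫ √(1
- a·y). -/
theorem tendsto_integral_peak (a : S3) :
    Tendsto (fun c => ∫ y, peak c a y ∂sphereMeasure) (𝓝[>] 1) (𝓝 (4 * √2 * Real.pi)) := by
  have h1 := tendsto_integral_zpw_half_mul a (h := fun _ => -(15 / 16)) continuous_const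
  have h2 : ∫ y : S3, √(1 - ⟪(a : R4), (y : R4)⟫_ℝ) * -(15 / 16) ∂sphereMeasure =
      -(4 * √2 * Real.pi) := by
    rw [integral_mul_const, integral_sqrt_one_sub_inner]
    ring
  rw [h2] at h1
  have h3 := h1.neg
  rw [neg_neg] at h3
  refine h3.congr' ?_
  filter_upwards [self_mem_nhdsWithin] with c hc
  have h4 := integral_zpw_half_mul_paneitz hc a (smoothS_const 1)
  simp only [paneitz_one, mul_one] at h4
  rw [h4, neg_neg]

theorem inner_eq_one_iff_eq (a y : S3) : ⟪(a : R4), (y : R4)⟫_ℝ = 1 ↔ a = y := by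
  rw [inner_eq_one_iff_of_norm_eq_one (norm_coe a) (norm_coe y), Subtype.ext_iff]

/-- Off a neighbourhood of a, compactness gives a·y ≤ m < 1. The negative power then stays bounded
by (1 - m)^(-7/2) while (c² - 1)² tends to 0. -/
theorem tendstoUniformlyOn_peak (a : S3) {u : Set S3} (hu : IsOpen u) (ha : a ∈ u) :
    TendstoUniformlyOn (fun c => peak c a) 0 (𝓝[>] 1) uᶜ := by
  obtain ⟨m, hm, hmy⟩ : ∃ m < 1, ∀ y ∈ uᶜ, ⟪(a : R4), (y : R4)⟫_ℝ ≤ m := by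
    rcases (uᶜ).eq_empty_or_nonempty with he | hne
    · exact ⟨0, by norm_num, by simp [he]⟩
    · obtain ⟨y, hy, hmax⟩ := hu.isClosed_compl.isCompact.exists_isMaxOn hne
        (continuous_inner_left a).continuousOn
      refine ⟨_, lt_of_le_of_ne (inner_mem_Icc a y).2 ?_, fun z hz => hmax hz⟩
      intro h
      exact hy ((inner_eq_one_iff_eq a y).1 h ▸ ha)
  have hlim : Tendsto (fun c : ℝ => 15 / 16 * (c ^ 2 - 1) ^ 2 * (1 - m) ^ (-(7 / 2) : ℝ)) (𝓝[>] 1)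
      (𝓝 0) := by
    have hc : Continuous (fun c : ℝ => 15 / 16 * (c ^ 2 - 1) ^ 2 * (1 - m) ^ (-(7 / 2) : ℝ)) := by
      fun_prop
    simpa using (hc.tendsto 1).mono_left nhdsWithin_le_nhds
  rw [Metric.tendstoUniformlyOn_iff]
  intro δ hδ
  filter_upwards [hlim.eventually (gt_mem_nhds hδ), self_mem_nhdsWithin] with c hc hc1 y hy
  have hpos := sub_inner_pos hc1 a y
  have h1 : zpw c (-(7 / 2)) a y ≤ (1 - m) ^ (-(7 / 2) : ℝ) :=
    Real.rpow_le_rpow_of_nonpos (sub_pos.2 hm) (by linarith [hmy y hy, mem_Ioi.1 hc1])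
      (by norm_num)
  have h0 : 0 ≤ zpw c (-(7 / 2)) a y := Real.rpow_nonneg hpos.le _
  rw [Pi.zero_apply, dist_zero_left, Real.norm_eq_abs, peak, abs_of_nonneg (by positivity)]
  exact lt_of_le_of_lt (mul_le_mul_of_nonneg_left h1 (by positivity)) hc

/-- Positivity, concentration at a and convergent mass make the peaks, divided by 4√2π, an
approximate identity. -/
theorem tendsto_integral_peak_mul (a : S3) {h : S3 → ℝ} (hh : Continuous h) :
    Tendsto (fun c => ∫ y, peak c a y * h y ∂sphereMeasure) (𝓝[>] 1)
      (𝓝 (4 * √2 * Real.pi * h a)) := by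
  set M := 4 * √2 * Real.pi with hM
  have hMpos : 0 < M := by positivity
  have key := tendsto_integral_peak_smul_of_integrable_of_tendsto (μ := sphereMeasure)
    (φ := fun c y => M⁻¹ * peak c a y) (l := 𝓝[>] 1) (x₀ := a) (g := h) (a := h a)
    MeasurableSet.univ univ_mem (measure_ne_top _ _) ?_ ?_ ?_ ?_ (integrable_sphere hh) (hh.tendsto a)
  · have h2 := key.const_mul M
    refine h2.congr fun c => ?_
    rw [← integral_const_mul]
    congr 1
    funext y
    rw [smul_eq_mul]
    field_simp
  · filter_upwards [self_mem_nhdsWithin] with c hc y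
    have h0 : 0 ≤ zpw c (-(7 / 2)) a y := Real.rpow_nonneg (sub_inner_pos hc a y).le _
    rw [peak]
    positivity
  · intro u hu ha
    have h1 := tendstoUniformlyOn_peak a hu ha
    rw [Metric.tendstoUniformlyOn_iff] at h1 ⊢
    intro δ hδ
    filter_upwards [h1 (M * δ) (by positivity)] with c hc y hy
    have h2 := hc y hy
    rw [Pi.zero_apply, dist_zero_left, Real.norm_eq_abs] at h2 ⊢
    rw [abs_mul, abs_of_pos (inv_pos.2 hMpos), inv_mul_lt_iff₀ hMpos]
    exact h2
  · simp only [Measure.restrict_univ, integral_const_mul]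
    have := (tendsto_integral_peak a).const_mul M⁻¹
    rwa [← hM, inv_mul_cancel₀ hMpos.ne'] at this
  · filter_upwards [self_mem_nhdsWithin] with c hc
    exact (continuous_const.mul (smoothS_peak hc a).continuous).aestronglyMeasurable

/-! ### The integral operator with kernel `kProfile` -/

theorem kProfile_eq (t : ℝ) : kProfile t = (4 * √2 * Real.pi)⁻¹ * √(1 - t) := by
  rw [kProfile, div_eq_inv_mul]

theorem continuous_kProfile : Continuous kProfile := by
  unfold kProfile
  fun_prop

theorem integral_kProfile_mul (a : S3) (h : S3 → ℝ) :
    ∫ y : S3, kProfile ⟪(a : R4), (y : R4)⟫_ℝ * h y ∂sphereMeasure = (4 * √2 * Real.pi)⁻¹ *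
      ∫ y : S3, √(1 - ⟪(a : R4), (y : R4)⟫_ℝ) * h y ∂sphereMeasure := by
  rw [← integral_const_mul]
  simp only [kProfile_eq, mul_assoc]

/-- Move P onto the regularised kernel √(c - a·y), then let c ↓ 1 on both sides. -/
theorem integral_kProfile_mul_paneitz (a : S3) {φ : S3 → ℝ} (hφ : SmoothS φ) :
    ∫ y : S3, kProfile ⟪(a : R4), (y : R4)⟫_ℝ * paneitz φ y ∂sphereMeasure = -φ a := by
  have h1 := tendsto_integral_zpw_half_mul a hφ.paneitz.continuous
  have h2 := (tendsto_integral_peak_mul a hφ.continuous).neg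
  have h3 := tendsto_nhds_unique (h1.congr' (by
    filter_upwards [self_mem_nhdsWithin] with c hc
    exact integral_zpw_half_mul_paneitz hc a hφ)) h2
  rw [integral_kProfile_mul, h3]
  have : (4 * √2 * Real.pi) ≠ 0 := by positivity
  field_simp

theorem kProfile_nonneg (t : ℝ) : 0 ≤ kProfile t := by
  rw [kProfile]
  positivity

theorem integral_kProfile (a : S3) :
    ∫ y : S3, kProfile ⟪(a : R4), (y : R4)⟫_ℝ ∂sphereMeasure = 16 / 15 := by
  have h := integral_kProfile_mul a (fun _ => 1)
  simp only [mul_one] at h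
  rw [h, integral_sqrt_one_sub_inner]
  field_simp
  norm_num

theorem abs_integral_kProfile_mul_le (a : S3) {h : S3 → ℝ} {M : ℝ} (hM : ∀ y, |h y| ≤ M) :
    |∫ y : S3, kProfile ⟪(a : R4), (y : R4)⟫_ℝ * h y ∂sphereMeasure| ≤ 16 / 15 * M := by
  have hc := continuous_kProfile
  have h1 := norm_integral_le_of_norm_le (μ := sphereMeasure)
    (f := fun y : S3 => kProfile ⟪(a : R4), (y : R4)⟫_ℝ * h y)
    (g := fun y : S3 => kProfile ⟪(a : R4), (y : R4)⟫_ℝ * M)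
    (integrable_sphere (by fun_prop)) (.of_forall fun y => ?_)
  · rwa [integral_mul_const, integral_kProfile] at h1
  · rw [norm_mul, Real.norm_eq_abs, Real.norm_eq_abs, abs_of_nonneg (kProfile_nonneg _)]
    exact mul_le_mul_of_nonneg_left (hM y) (kProfile_nonneg _)

/-- At a maximum point of |h| the equation gives max|h| ≤ (1/2)(16/15) max|h|, and the factor is
less than 1. -/
theorem eq_zero_of_eq_integral_kProfile {ε : ℝ} (h0 : 0 ≤ ε) (h1 : ε ≤ 1 / 2) {h : S3 → ℝ}
    (hh : Continuous h)
    (heq : ∀ x, h x = ε * ∫ y : S3, kProfile ⟪(x : R4), (y : R4)⟫_ℝ * h y ∂sphereMeasure) (x : S3) :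
    h x = 0 := by
  obtain ⟨x₀, -, hx₀⟩ := isCompact_univ.exists_isMaxOn ⟨x, mem_univ x⟩ hh.abs.continuousOn
  have hb : ∀ y, |h y| ≤ |h x₀| := fun y => hx₀ (mem_univ y)
  have h2 := abs_integral_kProfile_mul_le x₀ hb
  have h3 : |h x₀| = ε * |∫ y : S3, kProfile ⟪(x₀ : R4), (y : R4)⟫_ℝ * h y ∂sphereMeasure| := by
    conv_lhs => rw [heq x₀, abs_mul, abs_of_nonneg h0]
  have h4 : |h x₀| ≤ 1 / 2 * (16 / 15 * |h x₀|) := by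
    exact h3.trans_le (mul_le_mul h1 h2 (abs_nonneg _) (by norm_num))
  have h5 : |h x| ≤ 0 := (hb x).trans (by linarith)
  exact abs_eq_zero.1 (le_antisymm h5 (abs_nonneg _))

/-! ### Uniqueness of the Green's function -/

/-- Smoothness in the manifold sense is what `IsGreenFunction` requires of a test function. -/
theorem contMDiff_zpw {c : ℝ} (hc : 1 < c) (α : ℝ) (a : S3) :
    ContMDiff (𝓡 3) 𝓘(ℝ, ℝ) ∞ (zpw c α a) := by
  have : Fact (Module.finrank ℝ R4 = 3 + 1) := ⟨finrank_euclideanSpace_fin⟩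
  have h1 : ContMDiff (𝓡 3) 𝓘(ℝ, ℝ) ∞ (fun y : S3 => ⟪(a : R4), (y : R4)⟫_ℝ) :=
    (innerSL ℝ (a : R4)).contDiff.contMDiff.comp (contMDiff_coe_sphere (n := 3))
  intro y
  have h2 := (contDiffOn_sub_rpow c α).contDiffAt
    (isOpen_Iio.mem_nhds (sub_pos.1 (sub_inner_pos hc a y)))
  exact ContMDiffAt.comp (g := fun t : ℝ => (c - t) ^ α) y h2.contMDiffAt (h1 y)

/-- Fix x and let h be the difference of the two functions at x. It is orthogonal to (P + ε)√(c -
a·y) for every a and c > 1. In the limit c ↓ 1 this reads h = εKh. -/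
theorem IsGreenFunction.unique {ε : ℝ} (h0 : 0 ≤ ε) (h1 : ε ≤ 1 / 2) {G G' : S3 → S3 → ℝ}
    (hG : IsGreenFunction (fun φ p => paneitz φ p + ε * φ p) G)
    (hG' : IsGreenFunction (fun φ p => paneitz φ p + ε * φ p) G') : G' = G := by
  funext x y
  have hc : ∀ {G : S3 → S3 → ℝ}, Continuous (Function.uncurry G) → Continuous (G x) :=
    fun h => h.comp (Continuous.prodMk_right x)
  have hcG := hc hG.continuous
  have hcG' := hc hG'.continuous
  have hh : Continuous (fun y => G' x y - G x y) := hcG'.sub hcG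
  refine sub_eq_zero.1 (eq_zero_of_eq_integral_kProfile h0 h1 hh (fun a => ?_) y)
  have key : ∀ c : ℝ, 1 < c →
      ε * ∫ y, zpw c (1 / 2) a y * (G' x y - G x y) ∂sphereMeasure =
        ∫ y, peak c a y * (G' x y - G x y) ∂sphereMeasure := by
    intro c hc1
    have e1 := hG.integral_eq _ (contMDiff_zpw hc1 (1 / 2) a) x
    have e2 := hG'.integral_eq _ (contMDiff_zpw hc1 (1 / 2) a) x
    have c1 := (smoothS_zpw hc1 (1 / 2) a).continuous
    have c2 := (smoothS_peak hc1 a).continuous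
    simp only [paneitz_zpw_half hc1] at e1 e2
    rw [← sub_eq_zero, ← integral_const_mul,
      ← integral_sub (integrable_sphere (by fun_prop)) (integrable_sphere (by fun_prop))]
    rw [← sub_eq_zero.2 (e2.trans e1.symm),
      ← integral_sub (integrable_sphere (by fun_prop)) (integrable_sphere (by fun_prop))]
    congr 1
    funext y
    ring
  have l1 := (tendsto_integral_zpw_half_mul a hh).const_mul ε
  have l2 := tendsto_integral_peak_mul a hh
  have l3 := tendsto_nhds_unique (l1.congr' (by
    filter_upwards [self_mem_nhdsWithin] with c hc1 using key c hc1)) l2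
  rw [integral_kProfile_mul, mul_left_comm, l3]
  have : (4 * √2 * Real.pi) ≠ 0 := by positivity
  field_simp

/-! ### The Neumann series -/

theorem continuous_integral_sphere {X : Type*} [TopologicalSpace X] [FirstCountableTopology X]
    [LocallyCompactSpace X] {f : X → S3 → ℝ} (hf : Continuous (Function.uncurry f)) :
    Continuous fun x => ∫ y, f x y ∂sphereMeasure := by
  simpa using continuous_parametric_integral_of_continuous (μ := sphereMeasure) hf isCompact_univ

theorem integral_integral_swap_sphere {f : S3 → S3 → ℝ} (hf : Continuous (Function.uncurry f)) :
    ∫ x, ∫ y, f x y ∂sphereMeasure ∂sphereMeasure =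
      ∫ y, ∫ x, f x y ∂sphereMeasure ∂sphereMeasure :=
  integral_integral_swap
    (hf.integrable_of_hasCompactSupport (HasCompactSupport.of_compactSpace _))

theorem inner_pointAt (y : R4) (t : ℝ) : ⟪y, pointAt t⟫_ℝ = y 0 * √(1 - t ^ 2) + y 3 * t := by
  simp [pointAt, PiLp.inner_apply, Fin.sum_univ_four, mul_comm]

theorem exists_inner_eq {t : ℝ} (ht : t ∈ Icc (-1 : ℝ) 1) :
    ∃ z : S3, ⟪northPole, (z : R4)⟫_ℝ = t := by
  have h : 0 ≤ 1 - t ^ 2 := by nlinarith [ht.1, ht.2]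
  refine ⟨⟨pointAt t, ?_⟩, ?_⟩
  · rw [mem_sphere_zero_iff_norm]
    simp [pointAt, EuclideanSpace.norm_eq, Fin.sum_univ_four, Real.sq_sqrt h]
  · rw [inner_pointAt]
    simp [northPole]

/-- The north pole as a point of the sphere. -/
def north : S3 := ⟨northPole, by
  rw [mem_sphere_zero_iff_norm]
  simp [northPole, EuclideanSpace.norm_eq, Fin.sum_univ_four]⟩

theorem continuous_conv {k₁ k₂ : ℝ → ℝ} (h₁ : Continuous k₁) (h₂ : Continuous k₂) :
    Continuous (conv k₁ k₂) := by
  unfold conv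
  -- In this explicit form the integrand is jointly continuous for all real t, also outside [-1, 1].
  simp only [inner_pointAt]
  apply continuous_integral_sphere
  unfold Function.uncurry
  fun_prop

theorem continuous_convPow (j : ℕ) : Continuous (convPow kProfile j) := by
  induction j with
  | zero => exact continuous_kProfile
  | succ j ih => exact continuous_conv continuous_kProfile ih

theorem kProfile_inner_le (x y : S3) : kProfile ⟪(x : R4), (y : R4)⟫_ℝ ≤ 1 := by
  have h := (inner_mem_Icc x y).1
  have hpi := Real.pi_gt_three
  rw [kProfile, div_le_one (by positivity)]
  have h1 : √(1 - ⟪(x : R4), (y : R4)⟫_ℝ) ≤ √2 := Real.sqrt_le_sqrt (by linarith)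
  nlinarith [Real.sqrt_nonneg 2]

/-- Each convolution with k costs at most the factor 16/15, rounded up to 2. -/
theorem abs_convPow_inner_le (j : ℕ) (x y : S3) :
    |convPow kProfile j ⟪(x : R4), (y : R4)⟫_ℝ| ≤ 2 ^ j := by
  induction j generalizing x y with
  | zero =>
    rw [convPow, abs_of_nonneg (kProfile_nonneg _), pow_zero]
    exact kProfile_inner_le x y
  | succ j ih =>
    rw [convPow, conv_inner]
    have h := abs_integral_kProfile_mul_le x (fun z => ih z y)
    rw [pow_succ]
    linarith [pow_pos (two_pos : (0 : ℝ) < 2) j]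

/-- The profile of the negative of the Green's function of `P + ε`, as a Neumann series. -/
def neumann (ε t : ℝ) : ℝ := ∑' j : ℕ, ε ^ j * convPow kProfile j t

theorem abs_neumann_term_le {ε : ℝ} (h0 : 0 ≤ ε) (j : ℕ) (x y : S3) :
    ‖ε ^ j * convPow kProfile j ⟪(x : R4), (y : R4)⟫_ℝ‖ ≤ (2 * ε) ^ j := by
  rw [norm_mul, Real.norm_eq_abs, Real.norm_eq_abs, abs_of_nonneg (pow_nonneg h0 j), mul_pow,
    mul_comm]
  exact mul_le_mul_of_nonneg_right (abs_convPow_inner_le j x y) (pow_nonneg h0 j)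

theorem summable_two_mul_pow {ε : ℝ} (h0 : 0 ≤ ε) (h1 : ε ≤ 1 / 100) :
    Summable fun j : ℕ => (2 * ε) ^ j :=
  summable_geometric_of_lt_one (by linarith) (by linarith)

theorem hasSum_neumann_inner {ε : ℝ} (h0 : 0 ≤ ε) (h1 : ε ≤ 1 / 100) (x y : S3) :
    HasSum (fun j : ℕ => ε ^ j * convPow kProfile j ⟪(x : R4), (y : R4)⟫_ℝ)
      (neumann ε ⟪(x : R4), (y : R4)⟫_ℝ) :=
  (Summable.of_norm_bounded (summable_two_mul_pow h0 h1)
    fun j => abs_neumann_term_le h0 j x y).hasSum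

theorem abs_neumann_inner_le {ε : ℝ} (h0 : 0 ≤ ε) (h1 : ε ≤ 1 / 100) (x y : S3) :
    |neumann ε ⟪(x : R4), (y : R4)⟫_ℝ| ≤ 2 := by
  have h := tsum_of_norm_bounded (hasSum_geometric_of_lt_one (by linarith) (by linarith))
    fun j => abs_neumann_term_le h0 j x y
  refine le_trans h ?_
  rw [inv_le_comm₀ (by linarith) (by norm_num)]
  linarith

/-- Continuity is stated along inner products because the domination of the series is available only
for arguments in [-1, 1]. -/
theorem continuous_neumann_inner {ε : ℝ} (h0 : 0 ≤ ε) (h1 : ε ≤ 1 / 100) :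
    Continuous fun q : S3 × S3 => neumann ε ⟪(q.1 : R4), (q.2 : R4)⟫_ℝ := by
  have hj : ∀ j : ℕ, Continuous fun q : S3 × S3 =>
      ε ^ j * convPow kProfile j ⟪(q.1 : R4), (q.2 : R4)⟫_ℝ := by
    intro j
    have := continuous_convPow j
    fun_prop
  unfold neumann
  exact continuous_tsum hj (summable_two_mul_pow h0 h1)
    fun j q => abs_neumann_term_le h0 j q.1 q.2

theorem continuous_neumann_inner_comp {ε : ℝ} (h0 : 0 ≤ ε) (h1 : ε ≤ 1 / 100)
    {X : Type*} [TopologicalSpace X] {f g : X → S3} (hf : Continuous f) (hg : Continuous g) :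
    Continuous fun x => neumann ε ⟪(f x : R4), (g x : R4)⟫_ℝ :=
  (continuous_neumann_inner h0 h1).comp (hf.prodMk hg)

/-- Split off the term j = 0; in the rest, absolute convergence allows the sum and the integral to
be exchanged. -/
theorem neumann_inner_eq {ε : ℝ} (h0 : 0 ≤ ε) (h1 : ε ≤ 1 / 100) (x z : S3) :
    neumann ε ⟪(x : R4), (z : R4)⟫_ℝ = kProfile ⟪(x : R4), (z : R4)⟫_ℝ +
      ε * conv kProfile (neumann ε) ⟪(x : R4), (z : R4)⟫_ℝ := by
  have hk := continuous_kProfile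
  have hs := hasSum_neumann_inner h0 h1 x z
  rw [neumann, hs.summable.tsum_eq_zero_add]
  simp only [pow_zero, one_mul]
  congr 1
  have hint := hasSum_integral_of_summable_integral_norm (μ := sphereMeasure)
    (F := fun (j : ℕ) (y : S3) => kProfile ⟪(x : R4), (y : R4)⟫_ℝ *
      (ε ^ j * convPow kProfile j ⟪(y : R4), (z : R4)⟫_ℝ)) ?_ ?_
  · have h2 := hint.mul_left ε
    rw [conv_inner]
    have h3 : ∀ y : S3, ∑' j : ℕ, kProfile ⟪(x : R4), (y : R4)⟫_ℝ *
      (ε ^ j * convPow kProfile j ⟪(y : R4), (z : R4)⟫_ℝ) =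
        kProfile ⟪(x : R4), (y : R4)⟫_ℝ * neumann ε ⟪(y : R4), (z : R4)⟫_ℝ :=
      fun y => tsum_mul_left
    simp only [h3] at h2
    rw [← h2.tsum_eq]
    refine tsum_congr fun j => ?_
    rw [convPow, conv_inner, ← integral_const_mul, ← integral_const_mul]
    congr 1
    funext y
    ring
  · intro j
    have := continuous_convPow j
    exact integrable_sphere (by fun_prop)
  · apply Summable.of_nonneg_of_le (fun j => integral_nonneg fun y => norm_nonneg _) _
      ((summable_two_mul_pow h0 h1).mul_left (sphereMeasure.real univ))
    intro j
    have hb := norm_integral_le_of_norm_le_const (μ := sphereMeasure) (C := (2 * ε) ^ j)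
      (f := fun y : S3 => ‖kProfile ⟪(x : R4), (y : R4)⟫_ℝ *
        (ε ^ j * convPow kProfile j ⟪(y : R4), (z : R4)⟫_ℝ)‖) (.of_forall fun y => ?_)
    · rw [mul_comm (sphereMeasure.real univ)]
      exact (le_abs_self _).trans hb
    · rw [norm_norm, norm_mul]
      have e1 : ‖kProfile ⟪(x : R4), (y : R4)⟫_ℝ‖ ≤ 1 := by
        rw [Real.norm_eq_abs, abs_of_nonneg (kProfile_nonneg _)]
        exact kProfile_inner_le x y
      calc _ ≤ 1 * (2 * ε) ^ j :=
            mul_le_mul e1 (abs_neumann_term_le h0 j y z) (norm_nonneg _) zero_le_one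
        _ = _ := one_mul _

/-- Let W be the left side. Inserting N = k + ε k*N and using that k inverts -P gives W = -φ + εKφ +
εKW, so W + φ is fixed by εK and vanishes. -/
theorem integral_neumann_mul {ε : ℝ} (h0 : 0 ≤ ε) (h1 : ε ≤ 1 / 100)
    {φ : S3 → ℝ} (hφ : SmoothS φ) (x : S3) :
    ∫ y : S3, neumann ε ⟪(x : R4), (y : R4)⟫_ℝ * (paneitz φ y + ε * φ y) ∂sphereMeasure = -φ x := by
  have hk := continuous_kProfile
  have hc := hφ.continuous
  have hp := hφ.paneitz.continuous
  set ψ : S3 → ℝ := fun y => paneitz φ y + ε * φ y with hψ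
  have hψc : Continuous ψ := by fun_prop
  set W : S3 → ℝ := fun x => ∫ y : S3, neumann ε ⟪(x : R4), (y : R4)⟫_ℝ * ψ y ∂sphereMeasure with hW
  have hWc : Continuous W := by
    apply continuous_integral_sphere
    exact (continuous_neumann_inner_comp h0 h1 continuous_fst continuous_snd).mul
      (hψc.comp continuous_snd)
  have hnc : ∀ x : S3, Continuous fun y : S3 => neumann ε ⟪(x : R4), (y : R4)⟫_ℝ := fun x =>
    continuous_neumann_inner_comp h0 h1 continuous_const continuous_id
  have key : ∀ x, W x + φ x = ε * ∫ y : S3, kProfile ⟪(x : R4), (y : R4)⟫_ℝ * (W y + φ y)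
      ∂sphereMeasure := by
    intro x
    have hcc : Continuous fun y : S3 => conv kProfile (neumann ε) ⟪(x : R4), (y : R4)⟫_ℝ := by
      simp only [conv_inner]
      apply continuous_integral_sphere
      exact Continuous.mul (by fun_prop)
        (continuous_neumann_inner_comp h0 h1 continuous_snd continuous_fst)
    have e1 : W x = ∫ y : S3, kProfile ⟪(x : R4), (y : R4)⟫_ℝ * paneitz φ y ∂sphereMeasure +
        ε * ∫ y : S3, kProfile ⟪(x : R4), (y : R4)⟫_ℝ * φ y ∂sphereMeasure +
        ε * ∫ y : S3, conv kProfile (neumann ε) ⟪(x : R4), (y : R4)⟫_ℝ * ψ y ∂sphereMeasure := by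
      rw [← integral_const_mul, ← integral_const_mul,
        ← integral_add (integrable_sphere (by fun_prop)) (integrable_sphere (by fun_prop)),
        ← integral_add (integrable_sphere (by fun_prop)) (integrable_sphere (by fun_prop))]
      simp only [hW, neumann_inner_eq h0 h1, hψ]
      congr 1
      funext y
      ring
    have e2 : ∫ y : S3, conv kProfile (neumann ε) ⟪(x : R4), (y : R4)⟫_ℝ * ψ y ∂sphereMeasure =
        ∫ y : S3, kProfile ⟪(x : R4), (y : R4)⟫_ℝ * W y ∂sphereMeasure := by
      simp only [conv_inner, hW, ← integral_mul_const, ← integral_const_mul]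
      rw [integral_integral_swap_sphere]
      · simp only [mul_assoc]
      · unfold Function.uncurry
        refine (Continuous.mul (by fun_prop)
          (continuous_neumann_inner_comp h0 h1 continuous_snd continuous_fst)).mul (by fun_prop)
    rw [e1, e2, integral_kProfile_mul_paneitz x hφ]
    simp only [mul_add]
    rw [integral_add (integrable_sphere (by fun_prop)) (integrable_sphere (by fun_prop))]
    ring
  have h := eq_zero_of_eq_integral_kProfile h0 (by linarith) (hWc.add hc) key x
  exact eq_neg_of_add_eq_zero_left h

theorem isGreenFunction_neumann {ε : ℝ} (h0 : 0 ≤ ε) (h1 : ε ≤ 1 / 100) :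
    IsGreenFunction (fun φ p => paneitz φ p + ε * φ p)
      (fun x y => -neumann ε ⟪(x : R4), (y : R4)⟫_ℝ) where
  continuous := (continuous_neumann_inner h0 h1).neg
  integral_eq φ hφ x := by
    simp only [neg_mul, integral_neg]
    rw [integral_neumann_mul h0 h1 (smoothS_of_contMDiff hφ), neg_neg]

/-! ### Monotonicity -/

/-- Since ‖x - y‖² = 2(1 - x·y), the kernel is a multiple of the chordal distance, hence Lipschitz
in each point. -/
theorem kProfile_inner_eq (x y : S3) :
    kProfile ⟪(x : R4), (y : R4)⟫_ℝ = ‖(x : R4) - y‖ / (8 * Real.pi) := by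
  have h1 : ‖(x : R4) - y‖ = √2 * √(1 - ⟪(x : R4), (y : R4)⟫_ℝ) := by
    rw [← Real.sqrt_mul (by norm_num), ← Real.sqrt_sq (norm_nonneg ((x : R4) - y)),
      norm_sub_sq_real, norm_coe, norm_coe]
    congr 1
    ring
  have h2 : √2 * √2 = 2 := Real.mul_self_sqrt (by norm_num)
  have hpi := Real.pi_pos
  rw [h1, kProfile, div_eq_div_iff (by positivity) (by positivity)]
  linear_combination (-4 * Real.pi * √(1 - ⟪(x : R4), (y : R4)⟫_ℝ)) * h2

theorem abs_kProfile_inner_sub_le (x x' y : S3) :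
    |kProfile ⟪(x : R4), (y : R4)⟫_ℝ - kProfile ⟪(x' : R4), (y : R4)⟫_ℝ| ≤
      ‖(x : R4) - x'‖ / (8 * Real.pi) := by
  have hpi := Real.pi_pos
  rw [kProfile_inner_eq, kProfile_inner_eq, ← sub_div, abs_div,
    abs_of_pos (show 0 < 8 * Real.pi by positivity)]
  have h := abs_norm_sub_norm_le ((x : R4) - y) ((x' : R4) - y)
  rw [sub_sub_sub_cancel_right] at h
  gcongr

theorem integral_comp_rot (R : R4 ≃ₗᵢ[ℝ] R4) (f : S3 → ℝ) :
    ∫ y, f (rot R y) ∂sphereMeasure = ∫ y, f y ∂sphereMeasure :=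
  (rot_measurePreserving R).integral_comp
    ((Continuous.subtype_mk (R.continuous.comp continuous_subtype_val) _).measurableEmbedding
      fun _ _ hab => Subtype.ext (R.injective (congrArg Subtype.val hab))) f

/-- The displacement of x under the reflection is twice its projection onto the line of v. -/
theorem norm_sub_reflection_mul (v x : R4) :
    ‖x - (ℝ ∙ v)ᗮ.reflection x‖ * ‖v‖ = 2 * |⟪x, v⟫_ℝ| := by
  by_cases hv : v = 0
  · simp [hv]
  have hn : ‖v‖ ≠ 0 := norm_ne_zero_iff.2 hv
  rw [Submodule.reflection_orthogonal_apply, Submodule.reflection_singleton_apply, sub_neg_eq_add,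
    add_sub_cancel, ← Nat.cast_smul_eq_nsmul ℝ, norm_smul, norm_smul, real_inner_comm]
  simp only [Real.norm_eq_abs, abs_div, RCLike.ofReal_real_eq_id, id, Nat.cast_ofNat]
  rw [abs_of_nonneg (sq_nonneg ‖v‖), abs_of_pos (two_pos : (0 : ℝ) < 2)]
  field_simp

/-- The convolution of `k` with a function that is Lipschitz in the distance is Lipschitz in the
inner product. -/
theorem abs_conv_kProfile_sub_le {g : ℝ → ℝ} {Λ : ℝ} (x z z' : S3)
    (hg : ∀ w : S3, Continuous fun y : S3 => g ⟪(y : R4), (w : R4)⟫_ℝ)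
    (hL : ∀ y : S3, |g ⟪(y : R4), (z : R4)⟫_ℝ - g ⟪(y : R4), (z' : R4)⟫_ℝ| ≤
      Λ * ‖(z : R4) - z'‖) :
    |conv kProfile g ⟪(x : R4), (z : R4)⟫_ℝ - conv kProfile g ⟪(x : R4), (z' : R4)⟫_ℝ| ≤
      Real.pi / 4 * Λ * |⟪(x : R4), (z : R4)⟫_ℝ - ⟪(x : R4), (z' : R4)⟫_ℝ| := by
  have hk := continuous_kProfile
  have hpi := Real.pi_pos
  -- The reflection that exchanges z and z'; the difference D below is odd under it.
  let R : R4 ≃ₗᵢ[ℝ] R4 := (ℝ ∙ ((z : R4) - z'))ᗮ.reflection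
  have hRz : R z = z' := Submodule.reflection_sub (by rw [norm_coe, norm_coe])
  have hRR : ∀ y, R (R y) = y := fun y => Submodule.reflection_reflection _ y
  have hRz' : R z' = z := by rw [← hRz, hRR]
  have hR : ∀ u v : R4, ⟪u, R v⟫_ℝ = ⟪R u, v⟫_ℝ := fun u v => by
    rw [← R.inner_map_map u (R v), hRR]
  set D : S3 → ℝ := fun y => g ⟪(y : R4), (z : R4)⟫_ℝ - g ⟪(y : R4), (z' : R4)⟫_ℝ with hD
  have hDc : Continuous D := (hg z).sub (hg z')
  have e1 : conv kProfile g ⟪(x : R4), (z : R4)⟫_ℝ - conv kProfile g ⟪(x : R4), (z' : R4)⟫_ℝ =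
      ∫ y : S3, kProfile ⟪(x : R4), (y : R4)⟫_ℝ * D y ∂sphereMeasure := by
    have hgz := hg z
    have hgz' := hg z'
    have hkx : Continuous fun y : S3 => kProfile ⟪(x : R4), (y : R4)⟫_ℝ := by fun_prop
    have i1 : Continuous fun y : S3 =>
      kProfile ⟪(x : R4), (y : R4)⟫_ℝ * g ⟪(y : R4), (z : R4)⟫_ℝ := hkx.mul hgz
    have i2 : Continuous fun y : S3 =>
      kProfile ⟪(x : R4), (y : R4)⟫_ℝ * g ⟪(y : R4), (z' : R4)⟫_ℝ := hkx.mul hgz'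
    simp only [hD, mul_sub]
    rw [conv_inner, conv_inner, ← integral_sub (integrable_sphere i1) (integrable_sphere i2)]
  have e2 : ∫ y : S3, kProfile ⟪(x : R4), (y : R4)⟫_ℝ * D y ∂sphereMeasure =
      -∫ y : S3, kProfile ⟪(rot R x : R4), (y : R4)⟫_ℝ * D y ∂sphereMeasure := by
    rw [← integral_comp_rot R, ← integral_neg]
    congr 1
    funext y
    simp only [hD, rot, hR, ← hR (y : R4), hRz, hRz']
    ring
  -- Averaging with the reflected integral replaces k(x·y) by half of k(x·y) - k(Rx·y), which is
  -- small when x is near the mirror.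
  have e3 : 2 * ∫ y : S3, kProfile ⟪(x : R4), (y : R4)⟫_ℝ * D y ∂sphereMeasure =
      ∫ y : S3, (kProfile ⟪(x : R4), (y : R4)⟫_ℝ - kProfile ⟪(rot R x : R4), (y : R4)⟫_ℝ) * D y
        ∂sphereMeasure := by
    simp only [sub_mul]
    rw [integral_sub (integrable_sphere (by fun_prop)) (integrable_sphere (by fun_prop))]
    linarith
  have e4 := norm_integral_le_of_norm_le_const (μ := sphereMeasure)
    (f := fun y : S3 =>
      (kProfile ⟪(x : R4), (y : R4)⟫_ℝ - kProfile ⟪(rot R x : R4), (y : R4)⟫_ℝ) * D y)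
    (C := ‖(x : R4) - rot R x‖ / (8 * Real.pi) * (Λ * ‖(z : R4) - z'‖)) (.of_forall fun y => by
      rw [norm_mul]
      exact mul_le_mul (abs_kProfile_inner_sub_le x (rot R x) y) (hL y) (norm_nonneg _)
        (by positivity))
  -- Here the two distances combine into a difference of inner products. With the total mass 2π²,
  -- the constant is ½ · 1/(8π) · 2 · 2π² = π/4.
  have e5 : ‖(x : R4) - rot R x‖ * ‖(z : R4) - z'‖ =
      2 * |⟪(x : R4), (z : R4)⟫_ℝ - ⟪(x : R4), (z' : R4)⟫_ℝ| := by
    rw [← inner_sub_right]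
    exact norm_sub_reflection_mul _ _
  rw [← e3, sphereMeasure_real_univ, norm_mul, Real.norm_eq_abs, Real.norm_eq_abs,
    abs_of_pos (two_pos : (0 : ℝ) < 2)] at e4
  rw [e1]
  have e6 : ‖(x : R4) - rot R x‖ / (8 * Real.pi) * (Λ * ‖(z : R4) - z'‖) * (2 * Real.pi ^ 2) =
      2 * (Real.pi / 4 * Λ * |⟪(x : R4), (z : R4)⟫_ℝ - ⟪(x : R4), (z' : R4)⟫_ℝ|) := by
    field_simp
    linear_combination (Λ * 4) * e5
  linarith

/-- The difference of the roots is (t' - t)/(√(1 - t) + √(1 - t')), with denominator at most 2√2. -/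
theorem kProfile_sub_ge {t t' : ℝ} (ht : -1 ≤ t) (htt : t < t') (ht' : t' ≤ 1) :
    (t' - t) / (16 * Real.pi) ≤ kProfile t - kProfile t' := by
  have hpi := Real.pi_pos
  have ha : √(1 - t) ≤ √2 := Real.sqrt_le_sqrt (by linarith)
  have hb : √(1 - t') ≤ √2 := Real.sqrt_le_sqrt (by linarith)
  have ha2 : √(1 - t) ^ 2 = 1 - t := Real.sq_sqrt (by linarith)
  have hb2 : √(1 - t') ^ 2 = 1 - t' := Real.sq_sqrt (by linarith)
  have hab : √(1 - t') ≤ √(1 - t) := Real.sqrt_le_sqrt (by linarith)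
  have h2 : √2 ^ 2 = 2 := Real.sq_sqrt (by norm_num)
  have hs : 0 < √2 := by positivity
  rw [kProfile, kProfile, ← sub_div, div_le_div_iff₀ (by positivity) (by positivity)]
  have h3 : t' - t ≤ (√(1 - t) - √(1 - t')) * (2 * √2) := by
    nlinarith
  calc (t' - t) * (4 * √2 * Real.pi)
      ≤ (√(1 - t) - √(1 - t')) * (2 * √2) * (4 * √2 * Real.pi) := by gcongr
    _ = (√(1 - t) - √(1 - t')) * (16 * Real.pi) := by
      linear_combination (8 * Real.pi * (√(1 - t) - √(1 - t'))) * h2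

/-- Provides the input Λ = 1 for `abs_conv_kProfile_sub_le`. In N = k + ε k*N the dependence on z
can be put into k alone, which is Lipschitz, while the other factor is bounded by 2. -/
theorem abs_neumann_inner_sub_le {ε : ℝ} (h0 : 0 ≤ ε) (h1 : ε ≤ 1 / 100) (y z z' : S3) :
    |neumann ε ⟪(y : R4), (z : R4)⟫_ℝ - neumann ε ⟪(y : R4), (z' : R4)⟫_ℝ| ≤
      1 * ‖(z : R4) - z'‖ := by
  have hk := continuous_kProfile
  have hpi := Real.pi_gt_three
  have hpi4 := Real.pi_lt_four
  have hnc : Continuous fun w : S3 => neumann ε ⟪(w : R4), (y : R4)⟫_ℝ :=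
    continuous_neumann_inner_comp h0 h1 continuous_id continuous_const
  have hb := norm_integral_le_of_norm_le_const (μ := sphereMeasure)
    (f := fun w : S3 => (kProfile ⟪(z : R4), (w : R4)⟫_ℝ - kProfile ⟪(z' : R4), (w : R4)⟫_ℝ) *
      neumann ε ⟪(w : R4), (y : R4)⟫_ℝ)
    (C := ‖(z : R4) - z'‖ / (8 * Real.pi) * 2) (.of_forall fun w => by
      rw [norm_mul]
      exact mul_le_mul (abs_kProfile_inner_sub_le z z' w) (abs_neumann_inner_le h0 h1 w y)
        (norm_nonneg _) (by positivity))
  simp only [sub_mul] at hb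
  rw [integral_sub (integrable_sphere (by fun_prop)) (integrable_sphere (by fun_prop)),
    sphereMeasure_real_univ, Real.norm_eq_abs] at hb
  have ha := abs_kProfile_inner_sub_le z z' y
  rw [real_inner_comm, real_inner_comm (z' : R4), neumann_inner_eq h0 h1, neumann_inner_eq h0 h1,
    conv_inner, conv_inner]
  set N := ‖(z : R4) - z'‖
  have hN : 0 ≤ N := norm_nonneg _
  have e1 : N / (8 * Real.pi) ≤ N / 2 := by gcongr; linarith
  have e2 : N / (8 * Real.pi) * 2 * (2 * Real.pi ^ 2) ≤ 2 * N := by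
    have : N / (8 * Real.pi) * 2 * (2 * Real.pi ^ 2) = N * (Real.pi / 2) := by field_simp; norm_num
    nlinarith
  have ha' := abs_le.1 (ha.trans e1)
  have hb' := abs_le.1 (hb.trans e2)
  rw [abs_le]
  constructor <;> nlinarith

/-- The decrease of k, at rate at least 1/(16π), beats the variation of ε k*N, at rate at most επ/4
≤ π/400, since 16π² < 400. -/
theorem strictAntiOn_neumann {ε : ℝ} (h0 : 0 ≤ ε) (h1 : ε ≤ 1 / 100) :
    StrictAntiOn (neumann ε) (Icc (-1) 1) := by
  intro t ht t' ht' htt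
  have hpi := Real.pi_pos
  obtain ⟨z, hz⟩ := exists_inner_eq ht
  obtain ⟨z', hz'⟩ := exists_inner_eq ht'
  have hz1 : ⟪(north : R4), (z : R4)⟫_ℝ = t := hz
  have hz2 : ⟪(north : R4), (z' : R4)⟫_ℝ = t' := hz'
  have e1 := neumann_inner_eq h0 h1 north z
  have e2 := neumann_inner_eq h0 h1 north z'
  have e3 := abs_conv_kProfile_sub_le (g := neumann ε) (Λ := 1) north z z'
    (fun w => continuous_neumann_inner_comp h0 h1 continuous_id continuous_const)
    (fun y => abs_neumann_inner_sub_le h0 h1 y z z')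
  rw [hz1] at e1
  rw [hz2] at e2
  rw [hz1, hz2, abs_sub_comm t, abs_of_pos (sub_pos.2 htt)] at e3
  have e4 := kProfile_sub_ge ht.1 htt ht'.2
  have e5 := (abs_le.1 e3).1
  rw [e1, e2]
  have hlt : Real.pi / 400 * (t' - t) < (t' - t) / (16 * Real.pi) := by
    rw [lt_div_iff₀ (by positivity)]
    have h3 : Real.pi ^ 2 < 10 := by nlinarith [Real.pi_lt_d2]
    nlinarith [sub_pos.2 htt]
  have e6 : ε * (Real.pi / 4 * 1 * (t' - t)) ≤ 1 / 100 * (Real.pi / 4 * 1 * (t' - t)) := by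
    have := sub_pos.2 htt
    gcongr
  nlinarith [mul_le_mul_of_nonneg_left e5 h0]

end PaneitzSphere

end

theorem lemma4p1 :
    ∃ ε₀ : ℝ, 0 < ε₀ ∧ ∀ ε : ℝ, 0 < ε → ε < ε₀ →
      ∃ (G : S3 → S3 → ℝ) (kε : ℝ → ℝ),
        -- `G` is the Green's function of `P + ε`, and it is the only one
        IsGreenFunction (fun φ p => paneitz φ p + ε * φ p) G ∧
        (∀ G' : S3 → S3 → ℝ,
          IsGreenFunction (fun φ p => paneitz φ p + ε * φ p) G' → G' = G) ∧
        -- `kε` is the profile of the invariant kernel `-G`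
        (∀ x y : S3, kε ⟪(x : R4), (y : R4)⟫_ℝ = -G x y) ∧
        -- the Neumann series
        (∀ t ∈ Icc (-1 : ℝ) 1, HasSum (fun j : ℕ => ε ^ j * convPow kProfile j t) (kε t)) ∧
        StrictAntiOn kε (Icc (-1) 1) := by
  -- Any bound would do that makes the series converge (2ε < 1), makes εK contract and keeps επ/4
  -- below 1/(16π); 1/100 is a convenient choice.
  refine ⟨1 / 100, by norm_num, fun ε h0 h1 => ?_⟩
  have hG := isGreenFunction_neumann h0.le h1.le
  refine ⟨_, neumann ε, hG, fun G' hG' => hG.unique h0.le (by linarith) hG', fun x y => by simp,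
    fun t ht => ?_, strictAntiOn_neumann h0.le h1.le⟩
  obtain ⟨z, hz⟩ := exists_inner_eq ht
  have h := hasSum_neumann_inner h0.le h1.le north z
  rwa [show ⟪(north : R4), (z : R4)⟫_ℝ = t from hz] at h
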